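/- Let $K$ be an algebraically closed field of characteristic zero, let $n\ge 2$ and $s\ge 1$ be integers, and let $Z\subset\mathbb{P}^{n+s}_K$ be a (possibly reducible) closed subvariety of pure dimension $n-1$, regarded as a Zariski closed set of points. For an $(n+1)\times(n+s+1)$ matrix $A$ of rank $n+1$ over $K$, let $\pi_A:\mathbb{P}^{n+s}\setminus\Lambda_A\to\mathbb{P}^n$, $[v]\mapsto[Av]$, be the corresponding linear projection, whose center $\Lambda_A=\mathbb{P}(\ker A)$ is a linear subspace of dimension $s-1$. If the projection is sufficiently general, then $Z\cap\Lambda_A=\emptyset$ and the set $$\Sigma(Z,\pi_A)=\{q\in \pi_A(Z)\mid \pi_A^{-1}(q)\cap Z \text{ has at least } 3 \text{ distinct points}\}$$ has codimension at least $3$ in $\mathbb{P}^n$, that is, $\dim\overline{\Sigma(Z,\pi_A)}\le n-3$, with the convention $\dim\emptyset=-1$ (so that $\Sigma(Z,\pi_A)=\emptyset$ when $n=2$). Here "sufficiently general" means that there is a nonempty Zariski open subset of the affine space of $(n+1)\times(n+s+1)$ matrices over $K$, all of whose members $A$ have rank $n+1$ and satisfy the conclusion. -/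

import Mathlib

open scoped LinearAlgebra.Projectivization

/-- The set of points of projective `m`-space over a field `K`. -/
def PSpace (K : Type*) [Field K] (m : ℕ) : Type _ := ℙ K (Fin (m + 1) → K)

namespace PSpace

variable {K : Type*} [Field K]

/-- The vector of homogeneous coordinates of a point chosen by `Projectivization.rep`. -/
noncomputable def coords {m : ℕ} (p : PSpace K m) : Fin (m + 1) → K :=
  Projectivization.rep (K := K) (V := Fin (m + 1) → K) p

/-- The point with homogeneous coordinates `v ≠ 0`. -/
def ofCoords {m : ℕ} (v : Fin (m + 1) → K) (hv : v ≠ 0) : PSpace K m :=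
  Projectivization.mk K v hv

theorem coords_ne_zero {m : ℕ} (p : PSpace K m) : p.coords ≠ 0 :=
  Projectivization.rep_nonzero (K := K) (V := Fin (m + 1) → K) p

theorem exists_coords_ofCoords {m : ℕ} (v : Fin (m + 1) → K) (hv : v ≠ 0) :
    ∃ a : Kˣ, a • v = (ofCoords v hv).coords :=
  Projectivization.exists_smul_eq_mk_rep K v hv

/-- The common zero locus of the homogeneous members of a set of polynomials. -/
def zeroLocus {m : ℕ} (S : Set (MvPolynomial (Fin (m + 1)) K)) : Set (PSpace K m) :=
  {p | ∀ f ∈ S, (∃ d : ℕ, f.IsHomogeneous d) → MvPolynomial.eval p.coords f = 0}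

/-- The vanishing of a homogeneous polynomial does not depend on the homogeneous coordinates. -/
theorem eval_coords_ofCoords_eq_zero_iff {m : ℕ} {f : MvPolynomial (Fin (m + 1)) K} {d : ℕ}
    (hf : f.IsHomogeneous d) (v : Fin (m + 1) → K) (hv : v ≠ 0) :
    MvPolynomial.eval (ofCoords v hv).coords f = 0 ↔ MvPolynomial.eval v f = 0 := by
  obtain ⟨a, ha⟩ := exists_coords_ofCoords v hv
  rw [← ha]
  have h : MvPolynomial.eval (a • v) f = (a : K) ^ d * MvPolynomial.eval v f := by
    rw [MvPolynomial.eval_eq', MvPolynomial.eval_eq', Finset.mul_sum]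
    refine Finset.sum_congr rfl fun e he => ?_
    have hd : ∑ i, e i = d := by
      have h1 := hf (MvPolynomial.mem_support_iff.mp he)
      rw [Finsupp.weight_apply, Finsupp.sum_fintype _ _ (by simp)] at h1
      simpa using h1
    simp only [Units.smul_def, Pi.smul_apply, smul_eq_mul, mul_pow, Finset.prod_mul_distrib,
      Finset.prod_pow_eq_pow_sum, hd]
    ring
  rw [h]
  simp

/-- The Zariski topology: the closed sets are the zero loci of sets of homogeneous
polynomials. -/
instance zariskiTopology {m : ℕ} : TopologicalSpace (PSpace K m) :=
  TopologicalSpace.ofClosed {C | ∃ S : Set (MvPolynomial (Fin (m + 1)) K), C = zeroLocus S}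
    (by
      refine ⟨{1}, ?_⟩
      ext p
      simp only [zeroLocus, Set.mem_empty_iff_false, Set.mem_ofPred_eq, false_iff]
      intro h
      have := h 1 rfl ⟨0, MvPolynomial.isHomogeneous_one _ _⟩
      simp at this)
    (by
      intro 𝒜 h𝒜
      refine ⟨{f | ∃ S : Set (MvPolynomial (Fin (m + 1)) K), zeroLocus S ∈ 𝒜 ∧ f ∈ S}, ?_⟩
      ext p
      constructor
      · rintro hp f ⟨S, hS, hfS⟩ hf
        exact hp _ hS f hfS hf
      · intro hp C hC
        obtain ⟨S, rfl⟩ := h𝒜 hC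
        intro f hfS hf
        exact hp f ⟨S, hC, hfS⟩ hf)
    (by
      rintro _ ⟨S, rfl⟩ _ ⟨T, rfl⟩
      refine ⟨{h | ∃ f ∈ S, ∃ g ∈ T, (∃ d : ℕ, f.IsHomogeneous d) ∧
        (∃ e : ℕ, g.IsHomogeneous e) ∧ h = f * g}, ?_⟩
      ext p
      constructor
      · rintro (hp | hp) h ⟨f, hf, g, hg, hfd, hge, rfl⟩ -
        · rw [map_mul, hp f hf hfd, zero_mul]
        · rw [map_mul, hp g hg hge, mul_zero]
      · intro hp
        by_contra hcon
        simp only [Set.mem_union, not_or, zeroLocus, Set.mem_ofPred_eq, not_forall] at hcon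
        obtain ⟨⟨f, hf, ⟨d, hd⟩, hf0⟩, ⟨g, hg, ⟨e, he⟩, hg0⟩⟩ := hcon
        have := hp (f * g) ⟨f, hf, g, hg, ⟨d, hd⟩, ⟨e, he⟩, rfl⟩ ⟨d + e, hd.mul he⟩
        rw [map_mul] at this
        exact (mul_ne_zero hf0 hg0) this)

theorem isClosed_iff {m : ℕ} (C : Set (PSpace K m)) :
    IsClosed C ↔ ∃ S : Set (MvPolynomial (Fin (m + 1)) K), C = zeroLocus S := by
  rw [← isOpen_compl_iff]
  change Cᶜᶜ ∈ {C | ∃ S : Set (MvPolynomial (Fin (m + 1)) K), C = zeroLocus S} ↔ _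
  rw [compl_compl]
  rfl

/-- A closed subset `Z` of projective space is of pure dimension `d` if each of its irreducible
components has dimension `d`. -/
def IsPureDim {m : ℕ} (Z : Set (PSpace K m)) (d : ℕ) : Prop :=
  ∀ C ∈ irreducibleComponents Z, topologicalKrullDim C = d

/-- A subset `S` of projective `m`-space has codimension at least `c`, that is,
`dim S + c ≤ m`, the dimension of `S` being that of its Zariski closure. The empty set has
dimension `⊥`, so it has codimension at least `c` for every `c`. -/
def CodimAtLeast {m : ℕ} (S : Set (PSpace K m)) (c : ℕ) : Prop :=
  topologicalKrullDim (closure S) + c ≤ m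

variable {m n : ℕ}

/-- The center of the linear projection given by a matrix `A`: the points whose homogeneous
coordinates are killed by `A`. If `A` has rank `n + 1` it is a linear subspace of dimension
`m - n - 1`. -/
def center (A : Matrix (Fin (n + 1)) (Fin (m + 1)) K) : Set (PSpace K m) :=
  {p | A.mulVec p.coords = 0}

/-- The linear projection given by a matrix `A`, defined off its center. -/
noncomputable def proj (A : Matrix (Fin (n + 1)) (Fin (m + 1)) K)
    (p : {p : PSpace K m // p ∉ center A}) : PSpace K n :=
  ofCoords (A.mulVec p.1.coords) p.2

theorem ofCoords_mem_center_iff (A : Matrix (Fin (n + 1)) (Fin (m + 1)) K)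
    (v : Fin (m + 1) → K) (hv : v ≠ 0) : ofCoords v hv ∈ center A ↔ A.mulVec v = 0 := by
  obtain ⟨a, ha⟩ := exists_coords_ofCoords v hv
  rw [center, Set.mem_ofPred_eq, ← ha, Matrix.mulVec_smul, smul_eq_zero_iff_eq]

theorem proj_ofCoords (A : Matrix (Fin (n + 1)) (Fin (m + 1)) K)
    (v : Fin (m + 1) → K) (hv : v ≠ 0) (hA : A.mulVec v ≠ 0) :
    proj A ⟨ofCoords v hv, fun h => hA ((ofCoords_mem_center_iff A v hv).mp h)⟩ =
      ofCoords (A.mulVec v) hA := by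
  obtain ⟨a, ha⟩ := exists_coords_ofCoords v hv
  refine (Projectivization.mk_eq_mk_iff K _ _ _ _).mpr ⟨a, ?_⟩
  simp only [← ha, Matrix.mulVec_smul]

/-- The fiber over `q` of the restriction to `Z` of the projection given by `A`. -/
def projFiber (A : Matrix (Fin (n + 1)) (Fin (m + 1)) K) (Z : Set (PSpace K m))
    (q : PSpace K n) : Set (PSpace K m) :=
  {p | p ∈ Z ∧ ∃ hp : p ∉ center A, proj A ⟨p, hp⟩ = q}

/-- The image of `Z` under the projection given by `A`. -/
def projImage (A : Matrix (Fin (n + 1)) (Fin (m + 1)) K) (Z : Set (PSpace K m)) :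
    Set (PSpace K n) :=
  {q | ∃ p ∈ Z, ∃ hp : p ∉ center A, proj A ⟨p, hp⟩ = q}

/-- The points of the image of `Z` with at least three distinct preimages in `Z`. -/
def tripleLocus (A : Matrix (Fin (n + 1)) (Fin (m + 1)) K) (Z : Set (PSpace K m)) :
    Set (PSpace K n) :=
  {q | q ∈ projImage A Z ∧ 3 ≤ (projFiber A Z q).encard}

/-- `P` holds for a sufficiently general linear projection from projective `m`-space to
projective `n`-space: it holds for all matrices in a nonempty (basic) Zariski open subset
of the affine space of `(n + 1) × (m + 1)` matrices. -/
def ForGeneralProjection (P : Matrix (Fin (n + 1)) (Fin (m + 1)) K → Prop) : Prop :=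
  ∃ F : MvPolynomial (Fin (n + 1) × Fin (m + 1)) K, F ≠ 0 ∧
    ∀ A : Matrix (Fin (n + 1)) (Fin (m + 1)) K,
      MvPolynomial.eval (fun ij => A ij.1 ij.2) F ≠ 0 → P A

end PSpace

namespace PSpace

/-! ### Transcendence degree and Kähler differentials in characteristic zero -/

section Differentials

open AlgebraicIndependent KaehlerDifferential TensorProduct

variable {K L : Type*} [Field K] [Field L] [Algebra K L]

/-! The dimension count is carried out on generic points. Let `T` be the set of all bad
configurations: a matrix `A` and three distinct vectors `x`, `y`, `z` of the cone over `Z` with the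
same image. If the entries of `A` and `n - 1` chosen coordinates of `A x` satisfied no polynomial
relation on `T`, some prime of the ring of functions `T → K` would make them algebraically
independent in its residue field `L` (`exists_ne_zero_forall_eval_eq_zero`). This is impossible over
any `L` (`not_algebraicIndependent_of_three_points`). Specializing the relation to a general `A`
bounds the cone over the triple locus (`exists_specialization`, `length_add_two_le`).

Over `L`, each of `x`, `y`, `z` has transcendence degree at most `n`, by Noether normalization with
`n` linear forms (`eRk_range_le_of_linearForms`). A kernel vector recovers one column of `A` from
the others, and two independent ones recover two columns. If `y - x` and `z - x` are independent,
this forces `2(n+1) + (n-1) = 3n+1` independent quantities into the at most `3n` supplied by the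
points.

If the three vectors are collinear, one column gives `(n+1) + (n-1) = 2n`, so `x` and `y` have the
maximal joint rank `2n`. Differentiating `z = (1-t)x + ty` then shows that the direction of the line
has rank at most `n` (`eRk_direction_le`). But that direction is killed by `A`, whose independent
entries require rank at least `n + 1`. This is the analogue of the trisecant lemma, and it is where
characteristic zero enters: there, transcendence degree is the rank of differentials. -/

theorem linearIndependent_D_of_isTranscendenceBasis [CharZero K] {ι : Type*} {b : ι → L}
    (hb : IsTranscendenceBasis K b) : LinearIndependent L fun i => D K L (b i) := by
  let P := MvPolynomial ι K
  let : Algebra P L := (MvPolynomial.aeval b).toAlgebra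
  have : IsScalarTower K P L := IsScalarTower.of_algebraMap_eq' (by
    ext k; simp [RingHom.algebraMap_toAlgebra])
  have hinj : Function.Injective (algebraMap P L) := hb.1
  have : FaithfulSMul P L := (faithfulSMul_iff_algebraMap_injective P L).mpr hinj
  have halg : Algebra.IsAlgebraic P L := by
    refine ⟨fun x => ?_⟩
    obtain ⟨p, hp, hpx⟩ := hb.isAlgebraic.isAlgebraic x
    have hcomp : (algebraMap P L).comp (hb.1.aevalEquiv.symm : _ →+* P) =
        algebraMap (Algebra.adjoin K (Set.range b)) L := by
      ext y
      obtain ⟨y, rfl⟩ := hb.1.aevalEquiv.surjective y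
      simp [RingHom.algebraMap_toAlgebra]
    refine ⟨p.map (hb.1.aevalEquiv.symm : _ →+* P), ?_, ?_⟩
    · rwa [Polynomial.map_ne_zero_iff]
      exact hb.1.aevalEquiv.symm.injective
    · rwa [Polynomial.aeval_def, Polynomial.eval₂_map, hcomp]
  let : Algebra (FractionRing P) L := FractionRing.liftAlgebra P L
  have : IsScalarTower P (FractionRing P) L := inferInstance
  have : Algebra.IsAlgebraic (FractionRing P) L :=
    (IsFractionRing.comap_isAlgebraic_iff (A := P) (K := FractionRing P) (C := L)).mp halg
  have : CharZero (FractionRing P) :=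
    charZero_of_injective_algebraMap (R := K) (algebraMap K (FractionRing P)).injective
  -- Localization and a separable algebraic extension are both formally étale, so the differentials
  -- of `L` are the base change of those of the polynomial ring, with basis the `dX_i`.
  have : Algebra.FormallyEtale P (FractionRing P) := .of_isLocalization (nonZeroDivisors P)
  have : Algebra.FormallyEtale (FractionRing P) L := .of_isSeparable _ L
  have : Algebra.FormallyEtale P L := .comp P (FractionRing P) L
  let e := tensorKaehlerEquivOfFormallyEtale K P L
  let B := ((mvPolynomialBasis K ι).baseChange L).map e
  have hB : ∀ i, B i = D K L (b i) := by
    intro i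
    rw [Module.Basis.map_apply, Module.Basis.baseChange_apply, mvPolynomialBasis_apply,
      tensorKaehlerEquivOfFormallyEtale_apply]
    erw [mapBaseChange_tmul, one_smul, map_D]
    exact congrArg (D K L) (MvPolynomial.aeval_X b i)
  simpa only [← hB] using B.linearIndependent

theorem linearIndepOn_D_of_indep [CharZero K] {s : Set L} (hs : (matroid K L).Indep s) :
    LinearIndepOn L (D K L) s := by
  obtain ⟨t, ht, hst⟩ := hs.exists_isBase_superset
  have h : LinearIndepOn L (D K L) t :=
    linearIndependent_D_of_isTranscendenceBasis (matroid_isBase_iff.mp ht)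
  exact h.mono hst

/-- The universal derivation modulo the span kills `K(s)`. Applied to the minimal polynomial `p` of
`a`, it gives `p'(a) · da = 0`, and `p'(a) ≠ 0` by separability. -/
theorem D_mem_span_of_mem_closure [CharZero K] {s : Set L} {a : L}
    (ha : a ∈ (matroid K L).closure s) :
    D K L a ∈ Submodule.span L (D K L '' s) := by
  rw [matroid_closure_eq, SetLike.mem_coe, Subalgebra.mem_algebraicClosure] at ha
  set N := Submodule.span L (D K L '' s)
  let d : Derivation K L (_ ⧸ N) := N.mkQ.compDer (D K L)
  have hd : ∀ x, d x = 0 ↔ D K L x ∈ N := fun x => by simp [d]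
  let E := IntermediateField.adjoin K s
  have hE : ∀ x ∈ E, d x = 0 := by
    intro x hx
    induction hx using IntermediateField.adjoin_induction with
    | mem x hx => exact (hd x).mpr (Submodule.subset_span ⟨x, hx, rfl⟩)
    | algebraMap x => simp
    | add x y _ _ hx hy => rw [map_add, hx, hy, add_zero]
    | inv x _ hx => simp [Derivation.leibniz_inv, hx]
    | mul x y _ _ hx hy => simp [Derivation.leibniz, hx, hy]
  have : CharZero E := charZero_of_injective_algebraMap (algebraMap K E).injective
  have haE : IsAlgebraic E a := by
    obtain ⟨p, hp, hpa⟩ := ha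
    let φ : Algebra.adjoin K s →ₐ[K] E :=
      Subalgebra.inclusion (IntermediateField.algebra_adjoin_le_adjoin K s)
    refine ⟨p.map (φ : _ →+* E), ?_, ?_⟩
    · rwa [Polynomial.map_ne_zero_iff]
      exact Subalgebra.inclusion_injective (IntermediateField.algebra_adjoin_le_adjoin K s)
    · rw [Polynomial.aeval_def, Polynomial.eval₂_map]
      exact hpa
  have hsep : IsSeparable E a := (minpoly.irreducible haE.isIntegral).separable
  have hne := hsep.aeval_derivative_ne_zero (minpoly.aeval E a)
  have h := d.apply_aeval_eq (A := E) a (minpoly E a)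
  rw [minpoly.aeval, map_zero] at h
  have h0 : (d.compAlgebraMap E).mapCoeffs (minpoly E a) = 0 := by
    ext i
    simpa using hE _ ((minpoly E a).coeff i).2
  rw [h0] at h
  rw [← hd]
  simpa [hne] using h.symm

end Differentials

/-! ### Rank in the algebraic-independence matroid -/

section Rank

open AlgebraicIndependent KaehlerDifferential

variable {K L : Type*} [Field K] [Field L] [Algebra K L]

/-- A matroid basis of `s` has independent differentials, and these span all the others. Questions
of transcendence degree thus become linear algebra. -/
theorem finrank_span_D_eq_eRk [CharZero K] {s : Set L} (hs : s.Finite) :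
    (Module.finrank L (Submodule.span L (D K L '' s)) : ℕ∞) = (matroid K L).eRk s := by
  obtain ⟨I, hI⟩ := (matroid K L).exists_isBasis s
  have hspan : Submodule.span L (D K L '' s) = Submodule.span L (D K L '' I) := by
    refine le_antisymm (Submodule.span_le.mpr ?_) (Submodule.span_mono (Set.image_mono hI.subset))
    rintro _ ⟨a, ha, rfl⟩
    exact D_mem_span_of_mem_closure (hI.subset_closure ha)
  have hfin := hs.subset hI.subset
  have := hfin.fintype
  have hli : LinearIndependent L fun i : I => D K L i := linearIndepOn_D_of_indep hI.indep
  have h1 := finrank_span_eq_card hli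
  rw [← Set.image_eq_range] at h1
  rw [hspan, h1, ← hI.encard_eq_eRk, Set.encard_eq_coe_toFinset_card, Set.toFinset_card]

theorem card_le_eRk_of_algebraicIndependent {ι : Type*} [Fintype ι] {v : ι → L}
    (hv : AlgebraicIndependent K v) {s : Set L} (hs : Set.range v ⊆ s) :
    (Fintype.card ι : ℕ∞) ≤ (matroid K L).eRk s := by
  have h : (matroid K L).Indep (Set.range v) := hv.to_subtype_range
  refine le_trans ?_ (h.encard_le_eRk_of_subset hs)
  rw [← Set.image_univ, hv.injective.encard_image, Set.encard_univ, ENat.card_eq_coe_fintype_card]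

variable (K) in
/-- The relative algebraic closure in `L` of the field generated by `s` over `K`. -/
def acl (s : Set L) : IntermediateField K L where
  __ := (Subalgebra.algebraicClosure (Algebra.adjoin K s) L).restrictScalars K
  inv_mem' x hx := by
    change IsAlgebraic _ _
    exact IsAlgebraic.inv hx

theorem mem_acl {s : Set L} {a : L} : a ∈ acl K s ↔ a ∈ (matroid K L).closure s := by
  rw [matroid_closure_eq]; rfl

theorem subset_acl (s : Set L) : s ⊆ acl K s := fun a ha =>
  mem_acl.mpr ((matroid K L).mem_closure_of_mem ha)

theorem eRk_le_of_subset_acl {s t : Set L} (h : t ⊆ acl K s) :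
    (matroid K L).eRk t ≤ (matroid K L).eRk s := by
  rw [← (matroid K L).eRk_closure_eq s]
  exact (matroid K L).eRk_mono fun a ha => mem_acl.mp (h ha)

/-- If the entries of the columns of `A` in `J` and the members of `Y` are algebraic over the field
generated by `X` and the other columns, then `X` has at least the rank
that the independence of the entries of `A` and of `Y` requires. -/
theorem mul_card_add_le_eRk {r N y : ℕ} (A : Matrix (Fin r) (Fin N) L) (J : Finset (Fin N))
    (X Y : Set L)
    (hA : ∀ i, ∀ j ∈ J, A i j ∈ acl K (X ∪ Set.range fun p : Fin r × {j // j ∉ J} => A p.1 p.2))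
    (hY : Y ⊆ acl K (X ∪ Set.range fun p : Fin r × {j // j ∉ J} => A p.1 p.2))
    (h : ((r * N + y : ℕ) : ℕ∞) ≤
      (matroid K L).eRk (Set.range (fun p : Fin r × Fin N => A p.1 p.2) ∪ Y)) :
    ((r * J.card + y : ℕ) : ℕ∞) ≤ (matroid K L).eRk X := by
  set R := Set.range fun p : Fin r × {j // j ∉ J} => A p.1 p.2 with hR
  have h1 : Set.range (fun p : Fin r × Fin N => A p.1 p.2) ∪ Y ⊆ acl K (X ∪ R) := by
    refine Set.union_subset ?_ hY
    rintro _ ⟨⟨i, j⟩, rfl⟩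
    by_cases hj : j ∈ J
    · exact hA i j hj
    · exact subset_acl _ (Or.inr ⟨(i, ⟨j, hj⟩), rfl⟩)
  have h2 := h.trans ((eRk_le_of_subset_acl h1).trans
    ((matroid K L).eRk_union_le_eRk_add_eRk X R))
  have h3 : (matroid K L).eRk R ≤ ((r * (N - J.card) : ℕ) : ℕ∞) := by
    refine ((matroid K L).eRk_le_encard R).trans ?_
    rw [hR, ← Set.image_univ]
    refine (Set.encard_image_le _ _).trans ?_
    rw [Set.encard_univ, ENat.card_eq_coe_fintype_card]
    simp [Fintype.card_subtype_compl]
  have hJ : J.card ≤ N := by simpa using J.card_le_univ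
  have h4 := h2.trans (add_le_add_right h3 _)
  induction hX : (matroid K L).eRk X using ENat.recTopCoe with
  | top => exact le_top
  | coe e =>
    rw [hX] at h4
    norm_cast at h4 ⊢
    have h5 : r * N = r * J.card + r * (N - J.card) := by
      rw [← mul_add, Nat.add_sub_cancel' hJ]
    omega

end Rank

/-! ### Vectors in the kernel of a matrix with independent entries -/

section Kernel

open AlgebraicIndependent KaehlerDifferential

variable {K L : Type*} [Field K] [Field L] [Algebra K L]

/-- Where `u` has a nonzero coordinate, `A u = 0` can be solved for the corresponding column. Its
`r` entries must therefore be paid for by `X`. -/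
theorem mul_add_le_eRk_of_mulVec_eq_zero {r N y : ℕ} (A : Matrix (Fin r) (Fin N) L)
    (X Y : Set L) (u : Fin N → L) (hu : u ≠ 0) (huX : ∀ j, u j ∈ acl K X)
    (hAu : A.mulVec u = 0)
    (hY : Y ⊆ acl K (X ∪ Set.range fun p : Fin r × Fin N => A p.1 p.2))
    (h : ((r * N + y : ℕ) : ℕ∞) ≤
      (matroid K L).eRk (Set.range (fun p : Fin r × Fin N => A p.1 p.2) ∪ Y)) :
    ((r + y : ℕ) : ℕ∞) ≤ (matroid K L).eRk X := by
  obtain ⟨j₀, hj₀⟩ := Function.ne_iff.mp hu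
  set E := acl K (X ∪ Set.range fun p : Fin r × {j // j ∉ ({j₀} : Finset (Fin N))} => A p.1 p.2)
    with hE
  have hXE : acl K X ≤ E := fun a ha => mem_acl.mpr
    ((matroid K L).closure_subset_closure Set.subset_union_left (mem_acl.mp ha))
  have hAE : ∀ i, ∀ j ≠ j₀, A i j ∈ E := fun i j hj =>
    subset_acl _ (Or.inr ⟨(i, ⟨j, by simpa using hj⟩), rfl⟩)
  have hA0 : ∀ i, A i j₀ ∈ E := by
    intro i
    have h1 : A i j₀ * u j₀ + ∑ j ∈ Finset.univ.erase j₀, A i j * u j = 0 := by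
      rw [Finset.add_sum_erase _ (fun j => A i j * u j) (Finset.mem_univ j₀)]
      exact congrFun hAu i
    have h2 : A i j₀ = -(∑ j ∈ Finset.univ.erase j₀, A i j * u j) / u j₀ := by
      rw [eq_div_iff hj₀]; linear_combination h1
    rw [h2]
    refine div_mem (neg_mem (sum_mem fun j hj => mul_mem (hAE i j ?_) (hXE (huX j)))) (hXE (huX j₀))
    exact Finset.ne_of_mem_erase hj
  have hall : ∀ i j, A i j ∈ E := fun i j => by
    by_cases hj : j = j₀
    · exact hj ▸ hA0 i
    · exact hAE i j hj
  have := mul_card_add_le_eRk (y := y) A {j₀} X Y (fun i j _ => hall i j) ?_ h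
  · simpa using this
  · intro a ha
    have h1 := mem_acl.mp (hY ha)
    refine mem_acl.mpr (((matroid K L).closure_subset_closure_of_subset_closure ?_) h1)
    refine Set.union_subset (fun a ha => mem_acl.mp (hXE (subset_acl _ ha))) ?_
    rintro _ ⟨⟨i, j⟩, rfl⟩
    exact mem_acl.mp (hall i j)

theorem exists_minor_ne_zero {N : ℕ} {u v : Fin N → L} (h : LinearIndependent L ![u, v]) :
    ∃ a b, a ≠ b ∧ u a * v b - u b * v a ≠ 0 := by
  by_contra! hcon
  have hall : ∀ a b, u a * v b - u b * v a = 0 := fun a b => by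
    by_cases hab : a = b
    · subst hab; ring
    · exact hcon a b hab
  have hu : u ≠ 0 := by simpa using h.ne_zero 0
  obtain ⟨a, ha⟩ := Function.ne_iff.mp hu
  have h1 := LinearIndependent.pair_iff.mp h (-v a) (u a) (by
    ext b
    simp only [Pi.add_apply, Pi.smul_apply, smul_eq_mul, Pi.zero_apply]
    linear_combination hall a b)
  exact ha h1.2

/-- A nonzero `2 × 2` minor of `u`, `v` lets Cramer's rule recover two columns at once. -/
theorem two_mul_add_le_eRk_of_mulVec_eq_zero {r N y : ℕ} (A : Matrix (Fin r) (Fin N) L)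
    (X Y : Set L) (u v : Fin N → L) (huv : LinearIndependent L ![u, v])
    (huX : ∀ j, u j ∈ acl K X) (hvX : ∀ j, v j ∈ acl K X)
    (hAu : A.mulVec u = 0) (hAv : A.mulVec v = 0)
    (hY : Y ⊆ acl K (X ∪ Set.range fun p : Fin r × Fin N => A p.1 p.2))
    (h : ((r * N + y : ℕ) : ℕ∞) ≤
      (matroid K L).eRk (Set.range (fun p : Fin r × Fin N => A p.1 p.2) ∪ Y)) :
    ((r * 2 + y : ℕ) : ℕ∞) ≤ (matroid K L).eRk X := by
  obtain ⟨a, b, hab, hδ⟩ := exists_minor_ne_zero huv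
  set E := acl K (X ∪ Set.range fun p : Fin r × {j // j ∉ ({a, b} : Finset (Fin N))} => A p.1 p.2)
    with hE
  have hXE : acl K X ≤ E := fun a ha => mem_acl.mpr
    ((matroid K L).closure_subset_closure Set.subset_union_left (mem_acl.mp ha))
  have hAE : ∀ i, ∀ j, j ≠ a → j ≠ b → A i j ∈ E := fun i j hj hj' =>
    subset_acl _ (Or.inr ⟨(i, ⟨j, by simp [hj, hj']⟩), rfl⟩)
  have hsum : ∀ w : Fin N → L, A.mulVec w = 0 → (∀ j, w j ∈ acl K X) → ∀ i,
      A i a * w a + A i b * w b ∈ E := by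
    intro w hw hwX i
    have h1 : A i a * w a + (A i b * w b +
        ∑ j ∈ (Finset.univ.erase a).erase b, A i j * w j) = 0 := by
      rw [Finset.add_sum_erase _ (fun j => A i j * w j) (by simp [hab.symm]),
        Finset.add_sum_erase _ (fun j => A i j * w j) (Finset.mem_univ a)]
      exact congrFun hw i
    have h2 : A i a * w a + A i b * w b =
        -(∑ j ∈ (Finset.univ.erase a).erase b, A i j * w j) := by
      linear_combination h1
    rw [h2]
    refine neg_mem (sum_mem fun j hj => mul_mem (hAE i j ?_ ?_) (hXE (hwX j)))
    · exact Finset.ne_of_mem_erase (Finset.mem_of_mem_erase hj)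
    · exact Finset.ne_of_mem_erase hj
  have hδE : u a * v b - u b * v a ∈ E :=
    sub_mem (mul_mem (hXE (huX a)) (hXE (hvX b))) (mul_mem (hXE (huX b)) (hXE (hvX a)))
  have hall : ∀ i j, A i j ∈ E := fun i j => by
    have hu' := hsum u hAu huX i
    have hv' := hsum v hAv hvX i
    by_cases hja : j = a
    · have h1 : A i j = ((A i a * u a + A i b * u b) * v b - (A i a * v a + A i b * v b) * u b) /
          (u a * v b - u b * v a) := by
        rw [eq_div_iff hδ, hja]; ring
      rw [h1]
      exact div_mem (sub_mem (mul_mem hu' (hXE (hvX b))) (mul_mem hv' (hXE (huX b)))) hδE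
    · by_cases hjb : j = b
      · have h1 : A i j = ((A i a * v a + A i b * v b) * u a - (A i a * u a + A i b * u b) * v a) /
            (u a * v b - u b * v a) := by
          rw [eq_div_iff hδ, hjb]; ring
        rw [h1]
        exact div_mem (sub_mem (mul_mem hv' (hXE (huX a))) (mul_mem hu' (hXE (hvX a)))) hδE
      · exact hAE i j hja hjb
  have := mul_card_add_le_eRk (y := y) A {a, b} X Y (fun i j _ => hall i j) ?_ h
  · rwa [Finset.card_pair hab] at this
  · intro a ha
    have h1 := mem_acl.mp (hY ha)
    refine mem_acl.mpr (((matroid K L).closure_subset_closure_of_subset_closure ?_) h1)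
    refine Set.union_subset (fun a ha => mem_acl.mp (hXE (subset_acl _ ha))) ?_
    rintro _ ⟨⟨i, j⟩, rfl⟩
    exact mem_acl.mp (hall i j)

/-- If `x` and `y` have the maximal joint rank `2 * n` and a third point `z` of the line joining
them has rank at most `n`, then the direction of that line has rank at most `n`. -/
theorem eRk_direction_le [CharZero K] {N n : ℕ} {x y z : Fin N → L} {t : L}
    (hz : ∀ i, z i = (1 - t) * x i + t * y i) (ht0 : t ≠ 0) (ht1 : t ≠ 1)
    (hx : (matroid K L).eRk (Set.range x) ≤ n) (hy : (matroid K L).eRk (Set.range y) ≤ n)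
    (hzn : (matroid K L).eRk (Set.range z) ≤ n)
    (hxy : ((2 * n : ℕ) : ℕ∞) ≤ (matroid K L).eRk (Set.range x ∪ Set.range y))
    {j : Fin N} (hj : y j - x j ≠ 0) :
    (matroid K L).eRk (Set.range fun i => (y i - x i) / (y j - x j)) ≤ n := by
  classical
  have hspan : ∀ w : Fin N → L, (D K L '' Set.range w) = Set.range fun i => D K L (w i) := by
    intro w; rw [← Set.range_comp]; rfl
  set u : Fin N → L := fun i => y i - x i with hu
  set v : Fin N → L := fun i => (y i - x i) / (y j - x j) with hv
  let φ : (Fin N → L) → ((Fin N → L) →ₗ[L] Ω[L⁄K]) := fun w =>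
    Fintype.linearCombination L fun i => D K L (w i)
  have hφ : ∀ w c, φ w c = ∑ i, c i • D K L (w i) := fun w c => rfl
  have hrange : ∀ w, (φ w).range = Submodule.span L (D K L '' Set.range w) := by
    intro w; rw [hspan, Fintype.range_linearCombination]
  have hrk : ∀ w, ((Module.finrank L (φ w).range : ℕ) : ℕ∞) = (matroid K L).eRk (Set.range w) :=
    fun w => by rw [hrange, finrank_span_D_eq_eRk (Set.finite_range w)]
  have hker : ∀ w, Module.finrank L (φ w).range + Module.finrank L (φ w).ker = N := fun w => by
    rw [LinearMap.finrank_range_add_finrank_ker]; simp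
  have hx' : Module.finrank L (φ x).range ≤ n := by exact_mod_cast (hrk x).trans_le hx
  have hy' : Module.finrank L (φ y).range ≤ n := by exact_mod_cast (hrk y).trans_le hy
  have hz' : Module.finrank L (φ z).range ≤ n := by exact_mod_cast (hrk z).trans_le hzn
  have hsup : 2 * n ≤ Module.finrank L ↥((φ x).range ⊔ (φ y).range) := by
    rw [hrange, hrange, ← Submodule.span_union, ← Set.image_union]
    have h := finrank_span_D_eq_eRk (K := K) ((Set.finite_range x).union (Set.finite_range y))
    exact_mod_cast hxy.trans_eq h.symm
  -- Joint rank `2n` leaves no room for a common differential of `x` and `y`.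
  have hdisj : Disjoint (φ x).range (φ y).range := by
    rw [disjoint_iff, ← Submodule.finrank_eq_zero (R := L)]
    have := Submodule.finrank_sup_add_finrank_inf_eq (φ x).range (φ y).range
    omega
  let ψ : (Fin N → L) →ₗ[L] L := Fintype.linearCombination L u
  have hψ : ∀ c, ψ c = ∑ i, c i * u i := fun c => rfl
  -- Pairing `dz = (1-t)dx + t dy + u dt` with such a `c` removes the `dt` term. Disjointness then
  -- kills the `dx` and `dy` parts separately, hence also the `dv` part.
  have hW : (φ z).ker ⊓ ψ.ker ≤ (φ v).ker := by
    intro c hc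
    obtain ⟨hc1, hc2⟩ := hc
    rw [SetLike.mem_coe, LinearMap.mem_ker] at hc1 hc2
    have h1 : φ z c = (1 - t) • φ x c + t • φ y c + ψ c • D K L t := by
      simp only [hφ, hψ, Finset.smul_sum, Finset.sum_smul, ← Finset.sum_add_distrib]
      refine Finset.sum_congr rfl fun i _ => ?_
      rw [hz]
      simp only [map_add, map_sub, Derivation.leibniz, Derivation.map_one_eq_zero, hu]
      module
    rw [hc1, hc2, zero_smul, add_zero] at h1
    have h2 : (1 - t) • φ x c = -(t • φ y c) := eq_neg_of_add_eq_zero_left h1.symm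
    have h3 : (1 - t) • φ x c = 0 := by
      refine Submodule.disjoint_def.mp hdisj _ (Submodule.smul_mem _ _ ⟨c, rfl⟩) ?_
      rw [h2]
      exact neg_mem (Submodule.smul_mem _ _ ⟨c, rfl⟩)
    have hxc : φ x c = 0 := (smul_eq_zero.mp h3).resolve_left (sub_ne_zero.mpr ht1.symm)
    have hyc : φ y c = 0 := by
      rw [h3] at h2
      exact (smul_eq_zero.mp (neg_eq_zero.mp h2.symm)).resolve_left ht0
    rw [LinearMap.mem_ker]
    have h4 : φ v c = (y j - x j)⁻¹ • (φ y c - φ x c) + ψ c • D K L (y j - x j)⁻¹ := by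
      simp only [hφ, hψ, Finset.smul_sum, Finset.sum_smul, ← Finset.sum_add_distrib,
        ← Finset.sum_sub_distrib]
      refine Finset.sum_congr rfl fun i _ => ?_
      simp only [hv, hu, div_eq_mul_inv, Derivation.leibniz, map_sub]
      module
    rw [h4, hxc, hyc, hc2]
    simp
  -- The normalized coordinate `v j = 1` has zero differential, while `u j ≠ 0`. This makes the
  -- inclusion strict and regains the dimension lost to the condition `ψ c = 0`.
  have he : Pi.single j 1 ∈ (φ v).ker := by
    rw [LinearMap.mem_ker, hφ, Finset.sum_eq_single j]
    · simp [hv, div_self hj]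
    · intro i _ hi; simp [hi]
    · simp
  have he' : Pi.single j 1 ∉ (φ z).ker ⊓ ψ.ker := by
    rintro ⟨-, h⟩
    rw [SetLike.mem_coe, LinearMap.mem_ker, hψ, Finset.sum_eq_single j] at h
    · simp [hu] at h; exact hj h
    · intro i _ hi; simp [hi]
    · simp
  have hlt : Module.finrank L ↥((φ z).ker ⊓ ψ.ker) < Module.finrank L (φ v).ker :=
    Submodule.finrank_lt_finrank_of_lt (lt_of_le_of_ne hW fun h => he' (h ▸ he))
  have h5 := Submodule.finrank_sup_add_finrank_inf_eq (φ z).ker ψ.ker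
  have h6 : Module.finrank L ↥((φ z).ker ⊔ ψ.ker) ≤ N := by
    simpa using Submodule.finrank_le ((φ z).ker ⊔ ψ.ker)
  have h7 : Module.finrank L ψ.range + Module.finrank L ψ.ker = N := by
    rw [LinearMap.finrank_range_add_finrank_ker]; simp
  have h8 : Module.finrank L ψ.range ≤ 1 := by
    simpa using Submodule.finrank_le ψ.range
  have h9 := hker z
  have h10 := hker v
  rw [← hrk v]
  exact_mod_cast (by omega : Module.finrank L (φ v).range ≤ n)

end Kernel

/-! ### The dimension count over an extension field -/

section GenericPoint

open AlgebraicIndependent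

variable {K L : Type*} [Field K] [Field L] [Algebra K L]

theorem aeval_smul_of_isHomogeneous {σ : Type*} {f : MvPolynomial σ K} {d : ℕ}
    (hf : f.IsHomogeneous d) (a : L) (x : σ → L) :
    MvPolynomial.aeval (a • x) f = a ^ d * MvPolynomial.aeval x f := by
  rw [MvPolynomial.aeval_def, MvPolynomial.aeval_def, MvPolynomial.eval₂_eq,
    MvPolynomial.eval₂_eq, Finset.mul_sum]
  refine Finset.sum_congr rfl fun e he => ?_
  have hd : ∑ i ∈ e.support, e i = d := by
    have h1 := hf (MvPolynomial.mem_support_iff.mp he)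
    rw [Finsupp.weight_apply] at h1
    simpa [Finsupp.sum] using h1
  simp only [Pi.smul_apply, smul_eq_mul, mul_pow, Finset.prod_mul_distrib,
    Finset.prod_pow_eq_pow_sum, hd]
  ring

/-- The vector `x` over the extension `L` satisfies the homogeneous equations in `S`. -/
def Satisfies {N : ℕ} (S : Set (MvPolynomial (Fin N) K)) (x : Fin N → L) : Prop :=
  ∀ f ∈ S, (∃ d : ℕ, f.IsHomogeneous d) → MvPolynomial.aeval x f = 0

theorem Satisfies.smul {N : ℕ} {S : Set (MvPolynomial (Fin N) K)} {x : Fin N → L}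
    (hx : Satisfies S x) (a : L) : Satisfies S (a • x) := by
  rintro f hf ⟨d, hd⟩
  rw [aeval_smul_of_isHomogeneous hd, hx f hf ⟨d, hd⟩, mul_zero]

/-- If three points of rank at most `n` have the same image under a matrix with `n + 1` rows, then
the entries of the matrix and `n - 1` coordinates of the image are algebraically dependent. -/
theorem not_algebraicIndependent_of_three_points [CharZero K] {N n : ℕ} (hn : 1 ≤ n)
    {S : Set (MvPolynomial (Fin N) K)}
    (hS : ∀ x : Fin N → L, Satisfies S x → (matroid K L).eRk (Set.range x) ≤ n)
    (A : Matrix (Fin (n + 1)) (Fin N) L) {x y z : Fin N → L}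
    (hx : Satisfies S x) (hy : Satisfies S y) (hz : Satisfies S z)
    (hxy : x ≠ y) (hxz : x ≠ z) (hyz : y ≠ z)
    (hAxy : A.mulVec x = A.mulVec y) (hAxz : A.mulVec x = A.mulVec z)
    (σ : Fin (n - 1) → Fin (n + 1)) :
    ¬ AlgebraicIndependent K (Sum.elim (fun p : Fin (n + 1) × Fin N => A p.1 p.2)
      fun k => A.mulVec x (σ k)) := by
  intro hind
  set R := Set.range fun p : Fin (n + 1) × Fin N => A p.1 p.2 with hR
  set Y := Set.range fun k => A.mulVec x (σ k) with hY
  have hrk : (((n + 1) * N + (n - 1) : ℕ) : ℕ∞) ≤ (matroid K L).eRk (R ∪ Y) := by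
    have := card_le_eRk_of_algebraicIndependent hind (s := R ∪ Y) (by rw [Set.Sum.elim_range])
    simpa using this
  have hrk0 : (((n + 1) * N + 0 : ℕ) : ℕ∞) ≤ (matroid K L).eRk (R ∪ ∅) := by
    have h1 := hind.comp _ Sum.inl_injective
    have := card_le_eRk_of_algebraicIndependent h1 (s := R ∪ ∅)
      (by rw [Set.union_empty]; rfl)
    simpa using this
  have hYX : ∀ X : Set L, (∀ j, x j ∈ acl K X) → Y ⊆ acl K (X ∪ R) := by
    rintro X hX _ ⟨k, rfl⟩
    have hmono : acl K X ≤ acl K (X ∪ R) := fun a ha => mem_acl.mpr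
      ((matroid K L).closure_subset_closure Set.subset_union_left (mem_acl.mp ha))
    change ∑ j, A (σ k) j * x j ∈ acl K (X ∪ R)
    exact sum_mem fun j _ => mul_mem (subset_acl _ (Or.inr ⟨(σ k, j), rfl⟩)) (hmono (hX j))
  have hAu : A.mulVec (y - x) = 0 := by rw [Matrix.mulVec_sub, hAxy, sub_self]
  have hAv : A.mulVec (z - x) = 0 := by rw [Matrix.mulVec_sub, hAxz, sub_self]
  have hxX : ∀ X : Set L, Set.range x ⊆ X → ∀ j, x j ∈ acl K X := fun X h j =>
    subset_acl _ (h ⟨j, rfl⟩)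
  by_cases hli : LinearIndependent L ![y - x, z - x]
  -- Affinely independent points: `2(n+1) + (n-1) = 3n+1` exceeds the available `3n`.
  · set X := Set.range x ∪ Set.range y ∪ Set.range z
    have hxX : ∀ j, x j ∈ acl K X := fun j => subset_acl _ (Or.inl (Or.inl ⟨j, rfl⟩))
    have hyX : ∀ j, y j ∈ acl K X := fun j => subset_acl _ (Or.inl (Or.inr ⟨j, rfl⟩))
    have hzX : ∀ j, z j ∈ acl K X := fun j => subset_acl _ (Or.inr ⟨j, rfl⟩)
    have h1 := two_mul_add_le_eRk_of_mulVec_eq_zero A X Y _ _ hli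
      (fun j => sub_mem (hyX j) (hxX j)) (fun j => sub_mem (hzX j) (hxX j)) hAu hAv (hYX X hxX) hrk
    have h2 : (matroid K L).eRk X ≤ ((n + n + n : ℕ) : ℕ∞) := by
      push_cast
      exact ((matroid K L).eRk_union_le_eRk_add_eRk _ _).trans (add_le_add
        (((matroid K L).eRk_union_le_eRk_add_eRk _ _).trans (add_le_add (hS x hx) (hS y hy)))
        (hS z hz))
    have h3 := h1.trans h2
    norm_cast at h3
    omega
  · have hu : y - x ≠ 0 := sub_ne_zero.mpr hxy.symm
    obtain ⟨t, ht⟩ : ∃ t : L, t • (y - x) = z - x := by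
      by_contra! hcon
      exact hli ((LinearIndependent.pair_iff' hu).mpr hcon)
    have hz' : z = x + t • (y - x) := by rw [ht]; abel
    have ht0 : t ≠ 0 := by
      rintro rfl
      exact hxz (by simpa using hz'.symm)
    have ht1 : t ≠ 1 := by
      rintro rfl
      exact hyz (by simpa using hz'.symm)
    obtain ⟨j, hj⟩ := Function.ne_iff.mp hu
    replace hj : y j - x j ≠ 0 := hj
    -- The normalized direction is itself a kernel vector, so it alone must supply the `n + 1`
    -- entries of a column.
    have hdir : ¬ (matroid K L).eRk (Set.range fun i => (y i - x i) / (y j - x j)) ≤ n := by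
      intro hle
      have h1 := mul_add_le_eRk_of_mulVec_eq_zero (y := 0) A
        (Set.range fun i => (y i - x i) / (y j - x j)) ∅ (fun i => (y i - x i) / (y j - x j))
        (fun h => by simpa [hj] using congrFun h j) (fun i => subset_acl _ ⟨i, rfl⟩)
        (by
          have : (fun i => (y i - x i) / (y j - x j)) = (y j - x j)⁻¹ • (y - x) := by
            ext i; simp [div_eq_inv_mul]
          rw [this, Matrix.mulVec_smul, hAu, smul_zero])
        (Set.empty_subset _) hrk0
      have h2 := h1.trans hle
      norm_cast at h2
      omega
    by_cases hmax : ((2 * n : ℕ) : ℕ∞) ≤ (matroid K L).eRk (Set.range x ∪ Set.range y)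
    · refine hdir (eRk_direction_le (z := z) (t := t) (fun i => ?_) ht0 ht1 (hS x hx) (hS y hy)
        (hS z hz) hmax hj)
      rw [hz']
      simp only [Pi.add_apply, Pi.smul_apply, Pi.sub_apply, smul_eq_mul]
      ring
    -- Failure of maximal rank contradicts the one-column count, since `(n+1) + (n-1) = 2n`.
    · set X := Set.range x ∪ Set.range y
      have hxX : ∀ j, x j ∈ acl K X := fun j => subset_acl _ (Or.inl ⟨j, rfl⟩)
      have hyX : ∀ j, y j ∈ acl K X := fun j => subset_acl _ (Or.inr ⟨j, rfl⟩)
      have h1 := mul_add_le_eRk_of_mulVec_eq_zero A X Y (y - x) hu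
        (fun j => sub_mem (hyX j) (hxX j)) hAu (hYX X hxX) hrk
      have h2 : ((2 * n : ℕ) : ℕ∞) = ((n + 1 + (n - 1) : ℕ) : ℕ∞) := by
        congr 1; omega
      exact hmax (h2 ▸ h1)

/-- If a matrix with `n + 1` rows kills a nonzero vector of rank at most `n`, then its entries are
algebraically dependent. -/
theorem not_algebraicIndependent_of_mulVec_eq_zero {N n : ℕ}
    {S : Set (MvPolynomial (Fin N) K)}
    (hS : ∀ x : Fin N → L, Satisfies S x → (matroid K L).eRk (Set.range x) ≤ n)
    (A : Matrix (Fin (n + 1)) (Fin N) L) {x : Fin N → L}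
    (hx : Satisfies S x) (hx0 : x ≠ 0) (hAx : A.mulVec x = 0) :
    ¬ AlgebraicIndependent K (fun p : Fin (n + 1) × Fin N => A p.1 p.2) := by
  intro hind
  have hrk0 := card_le_eRk_of_algebraicIndependent hind (Set.subset_union_left (t := ∅))
  have h1 := (mul_add_le_eRk_of_mulVec_eq_zero (y := 0) A (Set.range x) ∅ x hx0
    (fun i => subset_acl _ ⟨i, rfl⟩) hAx (Set.empty_subset _) (by simpa using hrk0)).trans (hS x hx)
  norm_cast at h1
  omega

end GenericPoint

/-! ### Generic points as primes of the ring of all functions -/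

section GenericSpecialization

variable {K : Type*} [Field K]

theorem aeval_algebraMap_residueField {T σ : Type*} (P : Ideal (T → K)) [P.IsPrime]
    (w : σ → T → K) (f : MvPolynomial σ K) :
    MvPolynomial.aeval (fun i => algebraMap (T → K) P.ResidueField (w i)) f =
      algebraMap (T → K) P.ResidueField fun p => MvPolynomial.eval (fun i => w i p) f := by
  have h1 : MvPolynomial.aeval w f = fun p => MvPolynomial.eval (fun i => w i p) f := by
    ext p
    have := MvPolynomial.map_aeval w (Pi.evalRingHom (fun _ : T => K) p) f
    refine this.trans ?_
    rw [MvPolynomial.coe_eval₂Hom, MvPolynomial.eval, MvPolynomial.coe_eval₂Hom]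
    rfl
  rw [← h1]
  exact MvPolynomial.aeval_algebraMap_apply _ _ f

/-- If a family of functions on a set of points is algebraically dependent at each generic
point of that set, then it satisfies a polynomial relation. -/
theorem exists_ne_zero_forall_eval_eq_zero {T ι : Type*} (h : ι → T → K)
    (hdep : ∀ (P : Ideal (T → K)) [P.IsPrime],
      ¬ AlgebraicIndependent K fun i => algebraMap (T → K) P.ResidueField (h i)) :
    ∃ H : MvPolynomial ι K, H ≠ 0 ∧ ∀ p, MvPolynomial.eval (fun i => h i p) H = 0 := by
  by_contra! hcon
  -- If no nonzero polynomial vanishes on the whole family, the values of nonzero polynomials form a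
  -- multiplicative set avoiding `0`. Modulo a prime disjoint from it the family becomes
  -- independent.
  let M : Submonoid (T → K) :=
    (nonZeroDivisors (MvPolynomial ι K)).map (MvPolynomial.aeval h : MvPolynomial ι K →ₐ[K] T → K)
  have hM : Disjoint ((⊥ : Ideal (T → K)) : Set (T → K)) M := by
    rw [Set.disjoint_left]
    rintro _ h0 ⟨H, hH, rfl⟩
    obtain ⟨p, hp⟩ := hcon H (nonZeroDivisors.ne_zero hH)
    apply hp
    have h1 := MvPolynomial.map_aeval h (Pi.evalRingHom (fun _ : T => K) p) H
    have h2 : MvPolynomial.aeval h H = 0 := h0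
    rw [h2, map_zero] at h1
    rw [h1, MvPolynomial.coe_eval₂Hom, MvPolynomial.eval, MvPolynomial.coe_eval₂Hom]
    rfl
  obtain ⟨P, hP, -, hdisj⟩ := Ideal.exists_le_prime_disjoint ⊥ M hM
  refine hdep P ?_
  rw [algebraicIndependent_iff]
  intro H hH
  by_contra hne
  have h1 : MvPolynomial.aeval (fun i => algebraMap (T → K) P.ResidueField (h i)) H =
      algebraMap (T → K) P.ResidueField (MvPolynomial.aeval h H) :=
    MvPolynomial.aeval_algebraMap_apply _ _ H
  rw [h1, Ideal.algebraMap_residueField_eq_zero] at hH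
  exact Set.disjoint_left.mp hdisj hH ⟨H, mem_nonZeroDivisors_of_ne_zero hne, rfl⟩

/-- Since all functions on `T` are allowed, a nonvanishing coordinate can be chosen and inverted
pointwise. The coordinates therefore generate the unit ideal. -/
theorem exists_algebraMap_residueField_ne_zero {T ι : Type*} [Fintype ι] (P : Ideal (T → K))
    [P.IsPrime] (v : ι → T → K) (hv : ∀ p, ∃ i, v i p ≠ 0) :
    ∃ i, algebraMap (T → K) P.ResidueField (v i) ≠ 0 := by
  classical
  by_contra! hcon
  choose i hi using hv
  have h1 : ∑ j, (fun p => if j = i p then (v j p)⁻¹ else 0) * v j = 1 := by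
    ext p
    rw [Finset.sum_apply, Finset.sum_eq_single (i p)]
    · simp [hi p]
    · intro j _ hj; simp [hj]
    · simp
  have h2 := congrArg (algebraMap (T → K) P.ResidueField) h1
  rw [map_sum, map_one, Finset.sum_eq_zero fun j _ => by rw [map_mul, hcon, mul_zero]] at h2
  exact zero_ne_one h2

/-- A nonzero polynomial in two groups of variables stays nonzero under the specialization of the
first group to a general point. -/
theorem exists_specialization {ι κ : Type*} {H : MvPolynomial (ι ⊕ κ) K} (hH : H ≠ 0) :
    ∃ F : MvPolynomial ι K, F ≠ 0 ∧ ∀ a : ι → K, MvPolynomial.eval a F ≠ 0 →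
      ∃ G : MvPolynomial κ K, G ≠ 0 ∧
        ∀ b, MvPolynomial.eval b G = MvPolynomial.eval (Sum.elim a b) H := by
  let e := (MvPolynomial.sumAlgEquiv K κ ι)
  let H' := e (MvPolynomial.rename Sum.swap H)
  have hH' : H' ≠ 0 := by
    rw [ne_eq, EmbeddingLike.map_eq_zero_iff,
      (MvPolynomial.rename_injective _ Sum.swap_leftInverse.injective).eq_iff' (map_zero _)]
    exact hH
  -- With `H` read as a polynomial in the second group over the ring of the first, any nonzero
  -- coefficient serves as `F`.
  obtain ⟨d, hd⟩ := MvPolynomial.ne_zero_iff.mp hH'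
  refine ⟨H'.coeff d, hd, fun a ha => ⟨MvPolynomial.map (MvPolynomial.eval a) H', ?_, ?_⟩⟩
  · rw [MvPolynomial.ne_zero_iff]
    exact ⟨d, by rwa [MvPolynomial.coeff_map]⟩
  · intro b
    have key : ((MvPolynomial.eval b).comp (MvPolynomial.map (MvPolynomial.eval a))).comp
        ((e : _ →+* MvPolynomial κ (MvPolynomial ι K)).comp
          (MvPolynomial.rename Sum.swap : MvPolynomial (ι ⊕ κ) K →ₐ[K] _).toRingHom) =
        MvPolynomial.eval (Sum.elim a b) := by
      apply MvPolynomial.ringHom_ext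
      · intro r; simp [e]
      · rintro (i | i) <;> simp [e]
    exact RingHom.congr_fun key H

end GenericSpecialization

/-! ### Noether normalization by linear forms -/

section NoetherNormalization

open AlgebraicIndependent MvPolynomial

variable {K L : Type*} [Field K] [Field L] [Algebra K L]

theorem Satisfies.aeval_eq_zero_of_mem_span {N : ℕ} {S : Set (MvPolynomial (Fin N) K)}
    {x : Fin N → L} (hx : Satisfies S x) {f : MvPolynomial (Fin N) K}
    (hf : f ∈ Ideal.span {f | f ∈ S ∧ ∃ d : ℕ, f.IsHomogeneous d}) : aeval x f = 0 := by
  have h : Ideal.span {f | f ∈ S ∧ ∃ d : ℕ, f.IsHomogeneous d} ≤ RingHom.ker (aeval x) :=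
    Ideal.span_le.mpr fun g hg => hx g hg.1 hg.2
  exact h hf

/-- All forms of large degree lie in the ideal of a cone without points other than the origin. -/
theorem exists_forall_isHomogeneous_mem [IsAlgClosed K] {N : ℕ}
    (J : Ideal (MvPolynomial (Fin N) K))
    (hJ : ∀ x : Fin N → K, (∀ f ∈ J, eval x f = 0) → x = 0) :
    ∃ D : ℕ, ∀ p : MvPolynomial (Fin N) K, p.IsHomogeneous (D + 1) → p ∈ J := by
  -- By the Nullstellensatz every variable is nilpotent modulo `J`.
  have hrad : Ideal.span (Set.range (X : Fin N → MvPolynomial (Fin N) K)) ≤ J.radical := by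
    rw [← vanishingIdeal_zeroLocus_eq_radical (K := K), Ideal.span_le]
    rintro _ ⟨i, rfl⟩ x hx
    have hx0 := hJ x fun f hf => by simpa using hx f hf
    simp [hx0]
  obtain ⟨D, hD⟩ := Ideal.exists_pow_le_of_le_radical_of_fg hrad
    ⟨Finset.univ.map ⟨X, X_injective⟩, by simp⟩
  refine ⟨D, fun p hp => hD (Ideal.pow_le_pow_right (Nat.le_succ D) ?_)⟩
  rw [Ideal.mem_span_pow_iff_exists_isHomogeneous]
  exact ⟨p.map C, hp.map C, by rw [eval_map, eval₂_eta]⟩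

/-- Take the part of degree `D + 1` of an expression `f + ∑ c_k ℓ_k`. The part of `f` stays in the
homogeneous ideal and vanishes at `x`, and each `c_k` contributes only its part of degree `D`. -/
theorem exists_eq_sum_of_isHomogeneous {N n D : ℕ} {S : Set (MvPolynomial (Fin N) K)}
    {ℓ : Fin n → MvPolynomial (Fin N) K} (hℓ : ∀ k, (ℓ k).IsHomogeneous 1)
    {p : MvPolynomial (Fin N) K} (hp : p.IsHomogeneous (D + 1))
    (hmem : p ∈ Ideal.span {f | f ∈ S ∧ ∃ d : ℕ, f.IsHomogeneous d} ⊔ Ideal.span (Set.range ℓ))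
    {x : Fin N → L} (hx : Satisfies S x) :
    ∃ g : Fin n → MvPolynomial (Fin N) K, (∀ k, (g k).IsHomogeneous D) ∧
      aeval x p = ∑ k, aeval x (ℓ k) * aeval x (g k) := by
  let _ : GradedAlgebra (homogeneousSubmodule (Fin N) K) := gradedAlgebra
  have hI : (Ideal.span {f | f ∈ S ∧ ∃ d : ℕ, f.IsHomogeneous d}).IsHomogeneous
      (homogeneousSubmodule (Fin N) K) :=
    Ideal.homogeneous_span _ _ fun f hf => hf.2
  obtain ⟨f, hf, h, hh, rfl⟩ := Submodule.mem_sup.mp hmem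
  obtain ⟨c, rfl⟩ := (Ideal.mem_span_range_iff_exists_fun).mp hh
  refine ⟨fun k => DirectSum.decompose (homogeneousSubmodule (Fin N) K) (c k) D,
    fun k => (mem_homogeneousSubmodule _ _).mp (SetLike.coe_mem _), ?_⟩
  have h1 := DirectSum.decompose_of_mem_same (homogeneousSubmodule (Fin N) K) hp
  rw [← h1, DirectSum.decompose_add, DirectSum.add_apply, Submodule.coe_add, map_add,
    hx.aeval_eq_zero_of_mem_span (hI _ hf), zero_add, DirectSum.decompose_sum,
    DFinsupp.finsetSum_apply, AddSubmonoidClass.coe_finsetSum, map_sum]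
  refine Finset.sum_congr rfl fun k _ => ?_
  have h2 := DirectSum.coe_decompose_mul_of_right_mem_of_le (homogeneousSubmodule (Fin N) K)
    (a := c k) (n := D + 1) (hℓ k) (Nat.le_add_left 1 D)
  rw [h2, Nat.add_sub_cancel, map_mul, mul_comm]

/-- If `n` linear forms have no common zero on a projective variety, then its generic points have
rank at most `n`. -/
theorem eRk_range_le_of_linearForms [IsAlgClosed K] {N n : ℕ} {S : Set (MvPolynomial (Fin N) K)}
    {ℓ : Fin n → MvPolynomial (Fin N) K} (hℓ : ∀ k, (ℓ k).IsHomogeneous 1)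
    (hS : ∀ x : Fin N → K, Satisfies S x → (∀ k, eval x (ℓ k) = 0) → x = 0)
    {x : Fin N → L} (hx : Satisfies S x) : (matroid K L).eRk (Set.range x) ≤ n := by
  obtain ⟨D, hD⟩ := exists_forall_isHomogeneous_mem
    (Ideal.span {f | f ∈ S ∧ ∃ d : ℕ, f.IsHomogeneous d} ⊔ Ideal.span (Set.range ℓ))
    (fun x hx => hS x
      (fun f hf hd => by
        simpa [aeval_def] using hx f (Ideal.mem_sup_left (Ideal.subset_span ⟨hf, hd⟩)))
      fun k => hx _ (Ideal.mem_sup_right (Ideal.subset_span ⟨k, rfl⟩)))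
  set R := Set.range fun k => aeval x (ℓ k) with hR
  let V : ℕ → Submodule K L := fun d => (homogeneousSubmodule (Fin N) K d).map (aeval x).toLinearMap
  let W : Submodule K L := ⨆ d ∈ Finset.range (D + 1), V d
  -- The values of forms of degree at most `D` span a finite module over `K[ℓ(x)]`. It is stable
  -- under each `x i`, because degree `D + 1` is rewritten through the `ℓ k`. Hence each `x i` is
  -- integral over `K[ℓ(x)]`.
  let M : Submodule (Algebra.adjoin K R) L := Submodule.span _ (W : Set L)
  have hVW : ∀ d ≤ D, V d ≤ W := fun d hd =>
    le_iSup₂_of_le d (Finset.mem_range.mpr (by omega)) le_rfl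
  have hW : W.FG := Submodule.fg_biSup _ _ fun d _ => (homogeneousSubmodule_fg _ _ d).map _
  have hM : M.FG := by
    obtain ⟨s, hs⟩ := hW
    refine ⟨s, ?_⟩
    rw [← Submodule.span_span_of_tower K, hs]
  have h1 : (1 : L) ∈ M := Submodule.subset_span
    (hVW 0 (Nat.zero_le D) ⟨1, isHomogeneous_one _ _, map_one (aeval x)⟩)
  have hint : ∀ i, IsIntegral (Algebra.adjoin K R) (x i) := by
    intro i
    refine isIntegral_of_smul_mem_submodule M (fun h => ?_) hM (x i) fun w hw => ?_
    · rw [h] at h1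
      exact one_ne_zero ((Submodule.mem_bot _).mp h1)
    · have hV : ∀ d ≤ D, ∀ w ∈ V d, x i • w ∈ M := by
        rintro d hd _ ⟨p, hp, rfl⟩
        have hX : (X i * p).IsHomogeneous (d + 1) := by
          rw [add_comm]; exact (isHomogeneous_X K i).mul hp
        have hxp : x i • (aeval x).toLinearMap p = aeval x (X i * p) := by
          simp
        rw [hxp]
        rcases hd.lt_or_eq with hd | rfl
        · exact Submodule.subset_span (hVW (d + 1) hd ⟨_, hX, rfl⟩)
        · obtain ⟨g, hg, h⟩ := exists_eq_sum_of_isHomogeneous hℓ hX (hD _ hX) hx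
          rw [h]
          refine sum_mem fun k _ => ?_
          have hk : aeval x (ℓ k) ∈ Algebra.adjoin K R := Algebra.subset_adjoin ⟨k, rfl⟩
          exact M.smul_mem (⟨_, hk⟩ : Algebra.adjoin K R)
            (Submodule.subset_span (hVW d le_rfl ⟨g k, hg k, rfl⟩))
      induction hw using Submodule.span_induction with
      | mem w hw =>
        refine Submodule.iSup_induction' (motive := fun w _ => x i • w ∈ M) _ ?_ ?_ ?_ hw
        · intro d w hw
          by_cases hd : d ∈ Finset.range (D + 1)
          · rw [iSup_pos hd] at hw
            exact hV d (by simpa [Nat.lt_succ_iff] using hd) w hw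
          · rw [iSup_neg hd, Submodule.mem_bot] at hw
            rw [hw, smul_zero]; exact zero_mem _
        · rw [smul_zero]; exact zero_mem _
        · intro a b _ _ ha hb
          rw [smul_add]; exact add_mem ha hb
      | zero => rw [smul_zero]; exact zero_mem _
      | add a b _ _ ha hb => rw [smul_add]; exact add_mem ha hb
      | smul c a _ ha => rw [smul_comm]; exact M.smul_mem c ha
  have hacl : Set.range x ⊆ acl K R := by
    rintro _ ⟨i, rfl⟩
    exact (hint i).isAlgebraic
  refine (eRk_le_of_subset_acl hacl).trans (((matroid K L).eRk_le_encard R).trans ?_)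
  rw [hR, ← Set.image_univ]
  refine (Set.encard_image_le _ _).trans ?_
  simp

end NoetherNormalization

/-! ### Chains of irreducible closed sets -/

section Topology

open TopologicalSpace

variable {X : Type*} [TopologicalSpace X]

/-- The chains of irreducible closed subsets of `Z` have fewer than `d + 1` members. -/
def ChainsLT (Z : Set X) (d : ℕ) : Prop :=
  ∀ p : LTSeries (IrreducibleCloseds X), (p.last : Set X) ⊆ Z → p.length < d

theorem isIrreducible_preimage_val {Y A : Set X} (hA : IsIrreducible A) (hAY : A ⊆ Y) :
    IsIrreducible (Subtype.val ⁻¹' A : Set Y) := by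
  obtain ⟨⟨a, ha⟩, hpre⟩ := hA
  refine ⟨⟨⟨a, hAY ha⟩, ha⟩, ?_⟩
  rintro _ _ ⟨U, hU, rfl⟩ ⟨V, hV, rfl⟩ ⟨y, hyA, hyU⟩ ⟨z, hzA, hzV⟩
  obtain ⟨w, hwA, hw⟩ := hpre U V hU hV ⟨y, hyA, hyU⟩ ⟨z, hzA, hzV⟩
  exact ⟨⟨w, hAY hwA⟩, hwA, hw⟩

theorem coe_subset_last (p : LTSeries (IrreducibleCloseds X)) (i : Fin (p.length + 1)) :
    (p i : Set X) ⊆ p.last :=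
  p.strictMono.monotone (Fin.le_last i)

/-- A chain of irreducible closed sets contained in `Y` is a chain in the subspace `Y`. -/
theorem exists_series_subtype {Y : Set X} (p : LTSeries (IrreducibleCloseds X))
    (hp : (p.last : Set X) ⊆ Y) :
    ∃ q : LTSeries (IrreducibleCloseds Y), q.length = p.length ∧
      (q.last : Set Y) = Subtype.val ⁻¹' (p.last : Set X) := by
  refine ⟨LTSeries.mk p.length (fun i => ⟨Subtype.val ⁻¹' (p i : Set X),
    isIrreducible_preimage_val (p i).isIrreducible ((coe_subset_last p i).trans hp),
    (p i).isClosed.preimage continuous_subtype_val⟩) ?_, rfl, rfl⟩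
  intro i j hij
  have h : (p i : Set X) ⊂ p j := p.strictMono hij
  refine lt_of_le_of_ne (Set.preimage_mono h.1 : _) fun heq => h.2 fun x hx => ?_
  have h1 : (Subtype.val ⁻¹' (p i : Set X) : Set Y) = Subtype.val ⁻¹' (p j : Set X) :=
    congrArg (fun A : IrreducibleCloseds Y => (A : Set Y)) heq
  have hxY : x ∈ Y := hp (coe_subset_last p j hx)
  have h2 : (⟨x, hxY⟩ : Y) ∈ (Subtype.val ⁻¹' (p j : Set X) : Set Y) := hx
  rw [← h1] at h2
  exact h2

/-- A chain of irreducible closed sets of a closed subspace `Y` is a chain in the space. -/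
theorem exists_series_of_subtype {Y : Set X} (hY : IsClosed Y)
    (p : LTSeries (IrreducibleCloseds Y)) :
    ∃ q : LTSeries (IrreducibleCloseds X), q.length = p.length ∧ (q.last : Set X) ⊆ Y := by
  have hi : Topology.IsInducing (Subtype.val : Y → X) := .subtypeVal
  refine ⟨p.map _ (IrreducibleCloseds.map_strictMono_of_isInducing hi), rfl, ?_⟩
  rw [LTSeries.last_map, IrreducibleCloseds.coe_map]
  refine closure_minimal ?_ hY
  rintro _ ⟨y, -, rfl⟩
  exact y.2

/-- The largest member of a chain is irreducible, so the whole chain lies in one component. -/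
theorem chainsLT_of_components {Z : Set X} {d : ℕ}
    (h : ∀ C ∈ irreducibleComponents Z, topologicalKrullDim C = d) : ChainsLT Z (d + 1) := by
  intro p hp
  obtain ⟨q, hq, -⟩ := exists_series_subtype p hp
  obtain ⟨C, hC, hqC⟩ :=
    exists_mem_irreducibleComponents_subset_of_isIrreducible _ q.last.isIrreducible
  obtain ⟨r, hr, -⟩ := exists_series_subtype q hqC
  have h1 : (r.length : WithBot ℕ∞) ≤ topologicalKrullDim C := Order.LTSeries.length_le_krullDim r
  rw [h C hC, hr, hq] at h1
  have h2 : p.length ≤ d := by exact_mod_cast h1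
  omega

theorem topologicalKrullDim_add_le {Y : Set X} (hY : IsClosed Y) {c n : ℕ}
    (h : ∀ p : LTSeries (IrreducibleCloseds X), (p.last : Set X) ⊆ Y → p.length + c ≤ n) :
    topologicalKrullDim Y + c ≤ n := by
  by_cases hemp : IsEmpty (IrreducibleCloseds Y)
  · rw [topologicalKrullDim, Order.krullDim_eq_bot]
    simp
  · rw [not_isEmpty_iff] at hemp
    have hlen : ∀ p : LTSeries (IrreducibleCloseds Y), p.length + c ≤ n := fun p => by
      obtain ⟨q, hq, hqY⟩ := exists_series_of_subtype hY p
      exact hq ▸ h q hqY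
    obtain ⟨A⟩ := hemp
    -- A one-member chain makes the truncated subtraction `n - c` genuine. The case without chains
    -- has dimension `⊥`.
    have hc : c ≤ n := (Nat.le_add_left c _).trans (hlen (RelSeries.singleton _ A))
    have h1 : topologicalKrullDim Y ≤ ((n - c : ℕ) : WithBot ℕ∞) := by
      refine iSup_le fun p => ?_
      have := hlen p
      exact_mod_cast (by omega : p.length ≤ n - c)
    refine (add_le_add_left h1 _).trans ?_
    exact_mod_cast (by omega : n - c + c ≤ n)

end Topology

/-! ### Homogeneous ideals and hyperplane sections -/

section ClosedSets

open TopologicalSpace MvPolynomial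

variable {K : Type*} [Field K] {m : ℕ}

/-- The homogeneous ideal of a set of points. -/
noncomputable def homIdeal (C : Set (PSpace K m)) : Ideal (MvPolynomial (Fin (m + 1)) K) :=
  Ideal.span {f | (∃ d : ℕ, f.IsHomogeneous d) ∧ ∀ p ∈ C, eval p.coords f = 0}

theorem eval_coords_of_mem_homIdeal {C : Set (PSpace K m)} {f : MvPolynomial (Fin (m + 1)) K}
    (hf : f ∈ homIdeal C) {p : PSpace K m} (hp : p ∈ C) : eval p.coords f = 0 := by
  have h : homIdeal C ≤ RingHom.ker (eval p.coords) := Ideal.span_le.mpr fun g hg => hg.2 p hp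
  exact h hf

theorem mem_homIdeal {C : Set (PSpace K m)} {f : MvPolynomial (Fin (m + 1)) K} {d : ℕ}
    (hd : f.IsHomogeneous d) (hf : ∀ p ∈ C, eval p.coords f = 0) : f ∈ homIdeal C :=
  Ideal.subset_span ⟨⟨d, hd⟩, hf⟩

theorem mem_of_isClosed {C : Set (PSpace K m)} (hC : IsClosed C) {p : PSpace K m}
    (hp : ∀ f ∈ homIdeal C, eval p.coords f = 0) : p ∈ C := by
  obtain ⟨S, rfl⟩ := (isClosed_iff C).mp hC
  rintro f hf ⟨d, hd⟩
  exact hp f (mem_homIdeal hd fun q hq => hq f hf ⟨d, hd⟩)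

theorem homIdeal_lt_of_ssubset {C D : Set (PSpace K m)} (hC : IsClosed C) (h : C ⊂ D) :
    homIdeal D < homIdeal C := by
  refine lt_of_le_of_ne (Ideal.span_mono fun f hf => ⟨hf.1, fun p hp => hf.2 p (h.1 hp)⟩) ?_
  intro heq
  refine h.2 fun p hp => mem_of_isClosed hC fun f hf => ?_
  rw [← heq] at hf
  exact eval_coords_of_mem_homIdeal hf hp

instance noetherianSpace : NoetherianSpace (PSpace K m) := by
  have h : NoetherianSpace (PSpace K m) ↔ WellFoundedLT (Closeds (PSpace K m)) :=
    (noetherianSpace_TFAE (PSpace K m)).out 0 1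
  refine h.mpr ⟨Subrelation.wf (r := InvImage (· > ·)
    fun C : Closeds (PSpace K m) => homIdeal (C : Set (PSpace K m)))
    ?_ (InvImage.wf _ (wellFounded_gt))⟩
  intro C D h
  exact homIdeal_lt_of_ssubset C.isClosed h

/-- The linear form with coefficients `a`. -/
noncomputable def linearForm (a : Fin (m + 1) → K) : MvPolynomial (Fin (m + 1)) K :=
  ∑ i, C (a i) * X i

theorem isHomogeneous_linearForm (a : Fin (m + 1) → K) : (linearForm a).IsHomogeneous 1 :=
  IsHomogeneous.sum _ _ _ fun i _ => isHomogeneous_C_mul_X (a i) i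

/-- Over an infinite field, some functional is nonzero on each of finitely many nonzero vectors. -/
theorem exists_linearForm_ne_zero [Infinite K] {ι : Type*} [Finite ι] (p : ι → PSpace K m) :
    ∃ a : Fin (m + 1) → K, ∀ i, eval (p i).coords (linearForm a) ≠ 0 := by
  obtain ⟨f, hf⟩ := Module.exists_dual_forall_apply_ne_zero (K := K) (fun i => (p i).coords)
    fun i => (p i).coords_ne_zero
  refine ⟨fun j => f fun k => if j = k then 1 else 0, fun i => ?_⟩
  have h := hf i
  rw [LinearMap.pi_apply_eq_sum_univ] at h
  simpa [linearForm, mul_comm] using h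

theorem isClosed_eval_eq_zero {f : MvPolynomial (Fin (m + 1)) K} {d : ℕ} (hf : f.IsHomogeneous d) :
    IsClosed {p : PSpace K m | eval p.coords f = 0} := by
  rw [isClosed_iff]
  refine ⟨{f}, ?_⟩
  ext p
  simp only [zeroLocus, Set.mem_singleton_iff, forall_eq, Set.mem_ofPred_eq]
  exact ⟨fun h _ => h, fun h => h ⟨d, hf⟩⟩

/-- A suitable hyperplane section lowers the dimension. -/
theorem exists_linearForm_chainsLT [Infinite K] {Z : Set (PSpace K m)} (hZ : IsClosed Z) {d : ℕ}
    (hd : ChainsLT Z (d + 1)) :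
    ∃ a : Fin (m + 1) → K,
      ChainsLT (Z ∩ {p : PSpace K m | eval p.coords (linearForm a) = 0}) d := by
  obtain ⟨S, hS, hSc, hSi, rfl⟩ := NoetherianSpace.exists_finite_set_isClosed_irreducible hZ
  have := hS.to_subtype
  -- The hyperplane avoids a chosen point of each irreducible piece and so contains no piece. Any
  -- chain in the section can then be extended by the piece containing it.
  obtain ⟨a, ha⟩ := exists_linearForm_ne_zero fun t : S => (hSi t t.2).nonempty.some
  refine ⟨a, fun p hp => ?_⟩
  obtain ⟨t, ht, hpt⟩ := (isIrreducible_iff_sUnion_isClosed.mp p.last.isIrreducible)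
    hS.toFinset (by simpa using hSc) (by simpa using hp.trans Set.inter_subset_left)
  rw [Set.Finite.mem_toFinset] at ht
  let T : IrreducibleCloseds (PSpace K m) := ⟨t, hSi t ht, hSc t ht⟩
  have hlt : p.last < T := by
    refine lt_of_le_of_ne hpt fun h => ha ⟨t, ht⟩ ?_
    have h1 : (hSi t ht).nonempty.some ∈ (T : Set (PSpace K m)) := (hSi t ht).nonempty.some_mem
    rw [← h] at h1
    exact (hp h1).2
  have h1 := hd (p.snoc T hlt) (by
    rw [RelSeries.last_snoc]
    exact Set.subset_sUnion_of_mem ht)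
  simpa using h1

theorem exists_linearForms [Infinite K] (d : ℕ) {Z : Set (PSpace K m)} (hZ : IsClosed Z)
    (hd : ChainsLT Z d) :
    ∃ a : Fin d → Fin (m + 1) → K, ∀ p ∈ Z, ∃ k, eval p.coords (linearForm (a k)) ≠ 0 := by
  induction d generalizing Z with
  | zero =>
    refine ⟨Fin.elim0, fun p hp => ?_⟩
    have h : (closure {p} : Set (PSpace K m)) ⊆ Z :=
      closure_minimal (Set.singleton_subset_iff.mpr hp) hZ
    -- The closure of a point is already a chain of length `0`, so `ChainsLT Z 0` forces `Z` to be
    -- empty.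
    exact absurd (hd (RelSeries.singleton _
      ⟨closure {p}, isIrreducible_singleton.closure, isClosed_closure⟩) h) (Nat.not_lt_zero _)
  | succ d ih =>
    obtain ⟨a, ha⟩ := exists_linearForm_chainsLT hZ hd
    obtain ⟨b, hb⟩ := ih (hZ.inter (isClosed_eval_eq_zero (isHomogeneous_linearForm a))) ha
    refine ⟨Fin.cons a b, fun p hp => ?_⟩
    by_cases h : eval p.coords (linearForm a) = 0
    · obtain ⟨k, hk⟩ := hb p ⟨hp, h⟩
      exact ⟨k.succ, by simpa using hk⟩
    · exact ⟨0, by simpa using h⟩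

end ClosedSets

/-! ### Bounding chains by relations between coordinates -/

section ChainBound

open TopologicalSpace MvPolynomial AlgebraicIndependent

variable {K : Type*} [Field K]

/-- The coordinate ring of the prime `P` contains `N` algebraically independent elements. -/
def HasIndependent {R : Type*} [CommRing R] [Algebra K R] (P : Ideal R) (N : ℕ) : Prop :=
  ∃ (ι : Type) (_ : Fintype ι) (v : ι → R), Fintype.card ι = N ∧
    AlgebraicIndependent K fun i => Ideal.Quotient.mk P (v i)

/-- The new element is some `a` in `Q` but not in `P`. Were it algebraic over the others modulo `P`,
it would satisfy an equation with nonzero constant term. Reduction modulo `Q` kills `a` and turns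
that term into a relation among elements independent there. -/
theorem HasIndependent.succ {R : Type*} [CommRing R] [Algebra K R] {P Q : Ideal R} [P.IsPrime]
    (hPQ : P < Q) {N : ℕ} (h : HasIndependent (K := K) Q N) :
    HasIndependent (K := K) P (N + 1) := by
  obtain ⟨ι, _, v, hcard, hv⟩ := h
  obtain ⟨hle, a, haQ, haP⟩ := SetLike.lt_iff_le_and_exists.mp hPQ
  let π : R ⧸ P →ₐ[K] R ⧸ Q := Ideal.Quotient.factorₐ K hle
  have hπ : ∀ r, π (Ideal.Quotient.mk P r) = Ideal.Quotient.mk Q r := fun r => rfl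
  have hv' : AlgebraicIndependent K fun i => Ideal.Quotient.mk P (v i) :=
    AlgebraicIndependent.of_comp π hv
  refine ⟨Option ι, inferInstance, fun o => o.elim a v, by simp [hcard], ?_⟩
  have hopt : (fun o : Option ι => Ideal.Quotient.mk P (o.elim a v)) =
      fun o => o.elim (Ideal.Quotient.mk P a) fun i => Ideal.Quotient.mk P (v i) := by
    ext o; cases o <;> rfl
  rw [hopt, hv'.option_iff_transcendental]
  intro halg
  have ha0 : Ideal.Quotient.mk P a ∈ nonZeroDivisors (R ⧸ P) :=
    mem_nonZeroDivisors_of_ne_zero fun h => haP (Ideal.Quotient.eq_zero_iff_mem.mp h)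
  obtain ⟨p, hp0, hp⟩ := halg.exists_nonzero_coeff_and_aeval_eq_zero ha0
  obtain ⟨g, hg⟩ := hv'.aevalEquiv.surjective (p.coeff 0)
  have h1 := congrArg π hp
  have h2 : p = Polynomial.X * p.divX + Polynomial.C (p.coeff 0) :=
    (Polynomial.X_mul_divX_add p).symm
  rw [h2, map_add, map_mul, Polynomial.aeval_X, Polynomial.aeval_C, map_add, map_mul, hπ,
    Ideal.Quotient.eq_zero_iff_mem.mpr haQ, zero_mul, zero_add, map_zero, ← hg,
    hv'.algebraMap_aevalEquiv] at h1
  have h3 : aeval (fun i => Ideal.Quotient.mk Q (v i)) g = 0 := by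
    rw [← h1, ← AlgHom.comp_apply]
    congr 1
    ext i
    simp [hπ]
  have hg0 : g = 0 := hv.eq_zero_of_aeval_eq_zero g h3
  rw [hg0, map_zero] at hg
  exact hp0 hg.symm

theorem isPrime_homIdeal {m : ℕ} {C : Set (PSpace K m)} (hC : IsIrreducible C) :
    (homIdeal C).IsPrime := by
  let _ : GradedAlgebra (homogeneousSubmodule (Fin (m + 1)) K) := gradedAlgebra
  have hI : (homIdeal C).IsHomogeneous (homogeneousSubmodule (Fin (m + 1)) K) :=
    Ideal.homogeneous_span _ _ fun f hf => hf.1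
  refine hI.isPrime_of_homogeneous_mem_or_mem (fun h => ?_) ?_
  · obtain ⟨p, hp⟩ := hC.nonempty
    have h1 : (1 : MvPolynomial (Fin (m + 1)) K) ∈ homIdeal C := h ▸ Submodule.mem_top
    simpa using eval_coords_of_mem_homIdeal h1 hp
  · rintro f g ⟨d, hd⟩ ⟨e, he⟩ hfg
    have hsub : C ⊆ {p | eval p.coords f = 0} ∪ {p | eval p.coords g = 0} := fun p hp => by
      have := eval_coords_of_mem_homIdeal hfg hp
      rwa [map_mul, mul_eq_zero] at this
    rcases isPreirreducible_iff_isClosed_union_isClosed.mp hC.isPreirreducible _ _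
      (isClosed_eval_eq_zero hd) (isClosed_eval_eq_zero he) hsub with h | h
    · exact Or.inl (mem_homIdeal hd h)
    · exact Or.inr (mem_homIdeal he h)

theorem eval_smul_of_isHomogeneous {σ : Type*} {f : MvPolynomial σ K} {d : ℕ}
    (hf : f.IsHomogeneous d) (a : K) (x : σ → K) : eval (a • x) f = a ^ d * eval x f := by
  have h := aeval_smul_of_isHomogeneous (L := K) hf a x
  rwa [aeval_eq_eval, aeval_eq_eval] at h

/-- The vertex of the affine cone adds one step below every projective chain. -/
theorem homIdeal_lt_ker_eval_zero {m : ℕ} {C : Set (PSpace K m)} (hC : C.Nonempty) :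
    homIdeal C < RingHom.ker (eval (0 : Fin (m + 1) → K)) := by
  obtain ⟨p, hp⟩ := hC
  refine SetLike.lt_iff_le_and_exists.mpr ⟨Ideal.span_le.mpr ?_, ?_⟩
  · rintro f ⟨⟨d, hd⟩, hf⟩
    have h := eval_smul_of_isHomogeneous hd 0 p.coords
    rwa [zero_smul, hf p hp, mul_zero] at h
  · obtain ⟨i, hi⟩ := Function.ne_iff.mp p.coords_ne_zero
    exact ⟨X i, by simp [RingHom.mem_ker], fun h => hi (by
      simpa using eval_coords_of_mem_homIdeal h hp)⟩

theorem hasIndependent_homIdeal {m : ℕ} (p : LTSeries (IrreducibleCloseds (PSpace K m)))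
    (i : Fin (p.length + 1)) :
    HasIndependent (K := K) (homIdeal (p i : Set (PSpace K m))) (i + 1) := by
  have hprime : ∀ j, (homIdeal (p j : Set (PSpace K m))).IsPrime := fun j =>
    isPrime_homIdeal (p j).isIrreducible
  induction i using Fin.induction with
  | zero =>
    have := hprime 0
    refine HasIndependent.succ (homIdeal_lt_ker_eval_zero (p 0).isIrreducible.nonempty) ?_
    have hp : (RingHom.ker (eval (0 : Fin (m + 1) → K))).IsPrime := RingHom.ker_isPrime _
    refine ⟨Empty, inferInstance, Empty.elim, by simp, ?_⟩
    rw [algebraicIndependent_empty_type_iff]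
    exact RingHom.injective _
  | succ j ih =>
    have := hprime j.succ
    exact ih.succ (homIdeal_lt_of_ssubset (p j.castSucc).isClosed
      (p.strictMono j.castSucc_lt_succ))

/-- The coordinates generate the quotient ring, so they span its matroid, and independent elements
can be found among them. -/
theorem exists_algebraicIndependent_coords {σ : Type*} [Finite σ]
    {P : Ideal (MvPolynomial σ K)} [P.IsPrime] {N k : ℕ} (hk : k ≤ N)
    (h : HasIndependent (K := K) P N) :
    ∃ s : Fin k → σ, AlgebraicIndependent K fun i => Ideal.Quotient.mk P (X (s i)) := by
  obtain ⟨ι, _, v, hcard, hv⟩ := h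
  let x : σ → MvPolynomial σ K ⧸ P := fun i => Ideal.Quotient.mk P (X i)
  have hspan : (matroid K (MvPolynomial σ K ⧸ P)).Spanning (Set.range x) := by
    rw [matroid_spanning_iff]
    refine ⟨fun y => ?_⟩
    obtain ⟨f, rfl⟩ := Ideal.Quotient.mk_surjective y
    have hf : Ideal.Quotient.mk P f ∈ Algebra.adjoin K (Set.range x) := by
      rw [Algebra.adjoin_range_eq_range_aeval]
      refine ⟨f, ?_⟩
      have : (aeval x : MvPolynomial σ K →ₐ[K] _) = Ideal.Quotient.mkₐ K P := by
        ext i; simp [x]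
      exact DFunLike.congr_fun this f
    exact isAlgebraic_algebraMap (⟨_, hf⟩ : Algebra.adjoin K (Set.range x))
  have hind : (matroid K (MvPolynomial σ K ⧸ P)).Indep
      (Set.range fun i => Ideal.Quotient.mk P (v i)) := hv.to_subtype_range
  have h1 : (k : ℕ∞) ≤ (matroid K (MvPolynomial σ K ⧸ P)).eRk (Set.range x) := by
    rw [hspan.eRk_eq]
    refine le_trans ?_ hind.encard_le_eRank
    rw [← Set.image_univ, hv.injective.encard_image, Set.encard_univ, ENat.card_eq_coe_fintype_card,
      hcard]
    exact_mod_cast hk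
  obtain ⟨I, hIx, hI, hIk⟩ := Matroid.le_eRk_iff.mp h1
  have hfin : I.Finite := Set.finite_of_encard_eq_coe hIk
  have := hfin.to_subtype
  have hcardI : Nat.card I = k := by
    have h2 := hfin.encard_eq_coe_toFinset_card
    rw [hIk] at h2
    rw [Nat.card_coe_set_eq, Set.ncard_eq_toFinset_card I hfin]
    exact_mod_cast h2.symm
  let e : Fin k ≃ I := (Finite.equivFinOfCardEq hcardI).symm
  choose s hs using fun i : Fin k => hIx (e i).2
  refine ⟨s, ?_⟩
  have h3 : (fun i => Ideal.Quotient.mk P (X (s i))) =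
      fun i => ((e i : I) : MvPolynomial σ K ⧸ P) :=
    funext hs
  rw [h3]
  exact AlgebraicIndependent.comp (x := ((↑) : I → MvPolynomial σ K ⧸ P)) hI e e.injective

/-- If a polynomial vanishes on a line through the origin, then so do its homogeneous components. -/
theorem eval_homogeneousComponent_eq_zero [Infinite K] {σ : Type*} {g : MvPolynomial σ K}
    {v : σ → K} (hg : ∀ c : K, c ≠ 0 → eval (c • v) g = 0) (d : ℕ) :
    eval v (homogeneousComponent d g) = 0 := by
  let P : Polynomial K := ∑ i ∈ Finset.range (g.totalDegree + 1),
    Polynomial.monomial i (eval v (homogeneousComponent i g))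
  have hroot : ∀ c : K, c ≠ 0 → P.eval c = 0 := by
    intro c hc
    have h1 := hg c hc
    rw [← sum_homogeneousComponent g, map_sum] at h1
    refine Eq.trans ?_ h1
    rw [Polynomial.eval_finsetSum]
    refine Finset.sum_congr rfl fun i _ => ?_
    rw [Polynomial.eval_monomial, mul_comm,
      eval_smul_of_isHomogeneous (homogeneousComponent_isHomogeneous i g)]
  have hP : P = 0 := Polynomial.eq_zero_of_infinite_isRoot P
    ((Set.finite_singleton (0 : K)).infinite_compl.mono fun c hc => hroot c hc)
  by_cases hd : d < g.totalDegree + 1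
  · have h1 : P.coeff d = 0 := by rw [hP, Polynomial.coeff_zero]
    rw [Polynomial.finsetSum_coeff, Finset.sum_eq_single d, Polynomial.coeff_monomial_same] at h1
    · exact h1
    · intro i _ hi
      exact Polynomial.coeff_monomial_of_ne _ hi.symm
    · intro h
      exact absurd (Finset.mem_range.mpr hd) h
  · rw [homogeneousComponent_eq_zero d g (by omega), map_zero]

/-- A polynomial vanishing on the cone over `S` lies in the ideal of each subset of the
closure of `S`. -/
theorem mem_homIdeal_of_subset_closure [Infinite K] {m : ℕ} {S C : Set (PSpace K m)}
    (hC : C ⊆ closure S) {g : MvPolynomial (Fin (m + 1)) K}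
    (hg : ∀ q ∈ S, ∀ c : K, c ≠ 0 → eval (c • q.coords) g = 0) : g ∈ homIdeal C := by
  rw [← sum_homogeneousComponent g]
  refine sum_mem fun d _ => mem_homIdeal (homogeneousComponent_isHomogeneous d g) fun p hp => ?_
  have hsub : S ⊆ {p | eval p.coords (homogeneousComponent d g) = 0} := fun q hq =>
    eval_homogeneousComponent_eq_zero (hg q hq) d
  exact closure_minimal hsub
    (isClosed_eval_eq_zero (homogeneousComponent_isHomogeneous d g)) (hC hp)

/-- A chain of length at least `k - 1` would make some `k` coordinates independent modulo the prime
of its largest member, because the cone has one dimension more. The relation `G`, which vanishes on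
the whole cone over `S`, excludes this. -/
theorem length_add_two_le [Infinite K] {m k : ℕ} {S : Set (PSpace K m)}
    (hS : ∀ s : Fin k → Fin (m + 1), ∃ G : MvPolynomial (Fin k) K, G ≠ 0 ∧
      ∀ q ∈ S, ∀ c : K, c ≠ 0 → eval (fun i => c * q.coords (s i)) G = 0)
    (p : LTSeries (IrreducibleCloseds (PSpace K m)))
    (hp : (p.last : Set (PSpace K m)) ⊆ closure S) : p.length + 2 ≤ k := by
  by_contra! hlt
  have hprime : (homIdeal (p (Fin.last p.length) : Set (PSpace K m))).IsPrime :=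
    isPrime_homIdeal p.last.isIrreducible
  obtain ⟨s, hs⟩ := exists_algebraicIndependent_coords (k := k) (by simp; omega)
    (hasIndependent_homIdeal p (Fin.last _))
  obtain ⟨G, hG0, hG⟩ := hS s
  have hmem : rename s G ∈ homIdeal (p (Fin.last p.length) : Set (PSpace K m)) :=
    mem_homIdeal_of_subset_closure hp fun q hq c hc => by
      rw [eval_rename]; exact hG q hq c hc
  refine hG0 (hs.eq_zero_of_aeval_eq_zero G ?_)
  rw [← Ideal.Quotient.eq_zero_iff_mem] at hmem
  rw [← hmem]
  have : (aeval fun i => Ideal.Quotient.mk (homIdeal (p (Fin.last p.length) : Set (PSpace K m)))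
      (X (s i)) : MvPolynomial (Fin k) K →ₐ[K] _) = (Ideal.Quotient.mkₐ K _).comp (rename s) := by
    ext i; simp
  exact DFunLike.congr_fun this G

end ChainBound

universe u

/-! ### Polynomial conditions on a general matrix -/

section GenericMatrix

open MvPolynomial AlgebraicIndependent

variable {K : Type*} [Field K]

/-- The generic point of a family of vectors at a prime of the ring of functions. -/
noncomputable def genericVector {T σ : Type*} (P : Ideal (T → K)) [P.IsPrime] (w : T → σ → K) :
    σ → P.ResidueField :=
  fun i => algebraMap (T → K) P.ResidueField fun t => w t i

theorem satisfies_genericVector {T : Type*} {N : ℕ} {S : Set (MvPolynomial (Fin N) K)}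
    (P : Ideal (T → K)) [P.IsPrime] {w : T → Fin N → K} (hw : ∀ t, Satisfies S (w t)) :
    Satisfies S (genericVector P w) := by
  intro f hf hd
  have h : (fun t => eval (w t) f) = (0 : T → K) := funext fun t => by
    simpa [aeval_eq_eval] using hw t f hf hd
  have h1 := aeval_algebraMap_residueField P (fun i t => w t i) f
  rw [h, map_zero] at h1
  exact h1

theorem genericVector_ne {T σ : Type*} [Fintype σ] (P : Ideal (T → K)) [P.IsPrime]
    {v w : T → σ → K} (h : ∀ t, v t ≠ w t) : genericVector P v ≠ genericVector P w := by
  obtain ⟨i, hi⟩ := exists_algebraMap_residueField_ne_zero P (fun i t => v t i - w t i) fun t => by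
    obtain ⟨i, hi⟩ := Function.ne_iff.mp (h t)
    exact ⟨i, sub_ne_zero.mpr hi⟩
  intro heq
  apply hi
  have h1 : (fun t => v t i - w t i) = (fun t => v t i) - fun t => w t i := rfl
  rw [h1, map_sub, sub_eq_zero]
  exact congrFun heq i

theorem mulVec_genericVector {T : Type*} {r N : ℕ} (P : Ideal (T → K)) [P.IsPrime]
    (A : T → Matrix (Fin r) (Fin N) K) (w : T → Fin N → K) :
    Matrix.mulVec (Matrix.of fun i j => algebraMap (T → K) P.ResidueField fun t => A t i j)
      (genericVector P w) = genericVector P fun t => (A t).mulVec (w t) := by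
  ext i
  have h : (fun t => (A t).mulVec (w t) i) = ∑ j, (fun t => A t i j) * fun t => w t j := by
    ext t
    simp [Matrix.mulVec, dotProduct]
  simp only [genericVector, h, map_sum, map_mul]
  rfl

/-- The centers of general projections do not meet a variety of dimension less than `n`. -/
theorem exists_forall_mulVec_ne_zero {K : Type u} [Field K] {N n : ℕ}
    {S : Set (MvPolynomial (Fin N) K)}
    (hS : ∀ (L : Type u) [Field L] [Algebra K L] (x : Fin N → L),
      Satisfies S x → (matroid K L).eRk (Set.range x) ≤ n) :
    ∃ F : MvPolynomial (Fin (n + 1) × Fin N) K, F ≠ 0 ∧ ∀ A : Matrix (Fin (n + 1)) (Fin N) K,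
      eval (fun p => A p.1 p.2) F ≠ 0 → ∀ x, Satisfies S x → x ≠ 0 → A.mulVec x ≠ 0 := by
  -- The matrix varies too: a relation among its entries valid on all bad pairs is exactly a
  -- polynomial vanishing at every bad matrix.
  let T := {t : Matrix (Fin (n + 1)) (Fin N) K × (Fin N → K) //
    Satisfies S t.2 ∧ t.2 ≠ 0 ∧ t.1.mulVec t.2 = 0}
  obtain ⟨F, hF0, hF⟩ := exists_ne_zero_forall_eval_eq_zero
    (fun (p : Fin (n + 1) × Fin N) (t : T) => t.1.1 p.1 p.2) fun P _ =>
      not_algebraicIndependent_of_mulVec_eq_zero (hS P.ResidueField)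
        (Matrix.of fun i j => algebraMap (T → K) P.ResidueField fun t => t.1.1 i j)
        (satisfies_genericVector P (w := fun t => t.1.2) fun t => t.2.1) (fun h => by
          refine genericVector_ne P (v := fun t : T => t.1.2) (w := 0) (fun t => t.2.2.1) ?_
          rw [h]
          ext i
          exact (map_zero (algebraMap (T → K) P.ResidueField)).symm) (by
          rw [mulVec_genericVector P (fun t : T => t.1.1)]
          ext i
          have : (fun t : T => t.1.1.mulVec t.1.2 i) = 0 := funext fun t => by rw [t.2.2.2]; rfl
          simp only [genericVector, this, map_zero]
          rfl)
  exact ⟨F, hF0, fun A hA x hx hx0 hAx => hA (hF ⟨(A, x), hx, hx0, hAx⟩)⟩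

/-- The coordinates of the points of the image with three preimages under a general projection
satisfy a polynomial relation. -/
theorem exists_forall_relation {K : Type u} [Field K] [CharZero K] {N n : ℕ} (hn : 1 ≤ n)
    {S : Set (MvPolynomial (Fin N) K)}
    (hS : ∀ (L : Type u) [Field L] [Algebra K L] (x : Fin N → L),
      Satisfies S x → (matroid K L).eRk (Set.range x) ≤ n)
    (σ : Fin (n - 1) → Fin (n + 1)) :
    ∃ F : MvPolynomial (Fin (n + 1) × Fin N) K, F ≠ 0 ∧ ∀ A : Matrix (Fin (n + 1)) (Fin N) K,
      eval (fun p => A p.1 p.2) F ≠ 0 → ∃ G : MvPolynomial (Fin (n - 1)) K, G ≠ 0 ∧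
        ∀ x y z, Satisfies S x → Satisfies S y → Satisfies S z → x ≠ y → x ≠ z → y ≠ z →
          A.mulVec x = A.mulVec y → A.mulVec x = A.mulVec z →
          eval (fun k => A.mulVec x (σ k)) G = 0 := by
  let T := {t : Matrix (Fin (n + 1)) (Fin N) K × (Fin 3 → Fin N → K) //
    (∀ i, Satisfies S (t.2 i)) ∧ (t.2 0 ≠ t.2 1 ∧ t.2 0 ≠ t.2 2 ∧ t.2 1 ≠ t.2 2) ∧
      t.1.mulVec (t.2 0) = t.1.mulVec (t.2 1) ∧ t.1.mulVec (t.2 0) = t.1.mulVec (t.2 2)}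
  obtain ⟨H, hH0, hH⟩ := exists_ne_zero_forall_eval_eq_zero
    (Sum.elim (fun (p : Fin (n + 1) × Fin N) (t : T) => t.1.1 p.1 p.2)
      fun k t => t.1.1.mulVec (t.1.2 0) (σ k)) fun P _ hind => by
    have hsat := fun i => satisfies_genericVector P (w := fun t : T => t.1.2 i) fun t => t.2.1 i
    have hmul := fun i => mulVec_genericVector P (fun t : T => t.1.1) fun t => t.1.2 i
    refine not_algebraicIndependent_of_three_points hn (hS P.ResidueField)
      (Matrix.of fun i j => algebraMap (T → K) P.ResidueField fun t => t.1.1 i j)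
      (hsat 0) (hsat 1) (hsat 2) (genericVector_ne P fun t => t.2.2.1.1)
      (genericVector_ne P fun t => t.2.2.1.2.1) (genericVector_ne P fun t => t.2.2.1.2.2)
      ?_ ?_ σ ?_
    · rw [hmul, hmul]
      exact congrArg _ (funext fun t => t.2.2.2.1)
    · rw [hmul, hmul]
      exact congrArg _ (funext fun t => t.2.2.2.2)
    · rw [hmul]
      have heq : (fun i => algebraMap (T → K) P.ResidueField
          (Sum.elim (fun (p : Fin (n + 1) × Fin N) (t : T) => t.1.1 p.1 p.2)
            (fun k t => t.1.1.mulVec (t.1.2 0) (σ k)) i)) =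
          Sum.elim (fun p => algebraMap (T → K) P.ResidueField fun t => t.1.1 p.1 p.2)
            fun k => genericVector P (fun t : T => t.1.1.mulVec (t.1.2 0)) (σ k) := by
        ext (p | k) <;> rfl
      rw [heq] at hind
      exact hind
  -- Fixing a general matrix in `H` leaves a nonzero relation among the image coordinates alone.
  obtain ⟨F, hF0, hF⟩ := exists_specialization hH0
  refine ⟨F, hF0, fun A hA => ?_⟩
  obtain ⟨G, hG0, hG⟩ := hF _ hA
  refine ⟨G, hG0, fun x y z hx hy hz hxy hxz hyz hAxy hAxz => ?_⟩
  rw [hG, ← hH ⟨(A, ![x, y, z]), fun i => by fin_cases i <;> assumption, ⟨hxy, hxz, hyz⟩,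
    hAxy, hAxz⟩]
  congr 2
  ext (p | k) <;> rfl

theorem exists_forall_rank_eq {r N : ℕ} (h : r ≤ N) :
    ∃ F : MvPolynomial (Fin r × Fin N) K, F ≠ 0 ∧ ∀ A : Matrix (Fin r) (Fin N) K,
      eval (fun p => A p.1 p.2) F ≠ 0 → A.rank = r := by
  let M : Matrix (Fin r) (Fin r) (MvPolynomial (Fin r × Fin N) K) :=
    Matrix.of fun i j => X (i, Fin.castLE h j)
  have hM : ∀ a : Fin r × Fin N → K,
      eval a M.det = (Matrix.of fun i j => a (i, Fin.castLE h j)).det := fun a => by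
    rw [RingHom.map_det]
    congr 1
    ext i j
    simp [M]
  refine ⟨M.det, fun h0 => ?_, fun A hA => ?_⟩
  -- The leading minor is a nonzero polynomial because it equals `1` at the identity block.
  · have h1 := hM fun p => if (p.1 : ℕ) = p.2 then 1 else 0
    have h2 : (Matrix.of fun i j : Fin r =>
        (if ((i : Fin r) : ℕ) = (Fin.castLE h j : Fin N) then (1 : K) else 0)) = 1 := by
      ext i j
      simp [Matrix.one_apply, Fin.ext_iff]
    rw [h0, map_zero] at h1
    rw [h2, Matrix.det_one] at h1
    exact zero_ne_one h1
  · rw [hM] at hA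
    have hli : LinearIndependent K A.row := by
      have h1 := Matrix.linearIndependent_rows_of_det_ne_zero hA
      refine LinearIndependent.of_comp (LinearMap.funLeft K K (Fin.castLE h)) ?_
      exact h1
    simpa using hli.rank_matrix

end GenericMatrix

/-! ### Homogeneous coordinates of points and fibers -/

section Points

open MvPolynomial

variable {K : Type*} [Field K] {m n : ℕ}

theorem satisfies_coords {S : Set (MvPolynomial (Fin (m + 1)) K)} {p : PSpace K m}
    (hp : p ∈ zeroLocus S) : Satisfies S p.coords := fun f hf hd => by
  rw [aeval_eq_eval]; exact hp f hf hd

theorem ofCoords_mem_zeroLocus {S : Set (MvPolynomial (Fin (m + 1)) K)} {x : Fin (m + 1) → K}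
    (hx : Satisfies S x) (hx0 : x ≠ 0) : ofCoords x hx0 ∈ zeroLocus S := by
  rintro f hf ⟨d, hd⟩
  rw [eval_coords_ofCoords_eq_zero_iff hd]
  have h := hx f hf ⟨d, hd⟩
  rwa [aeval_eq_eval] at h

theorem eq_of_smul_coords_eq {p q : PSpace K m} {a b : K} (ha : a ≠ 0)
    (h : a • p.coords = b • q.coords) : p = q := by
  have h1 : ∃ c : K, c • q.coords = p.coords :=
    ⟨a⁻¹ * b, by rw [mul_smul, ← h, smul_smul, inv_mul_cancel₀ ha, one_smul]⟩
  have h2 := (Projectivization.mk_eq_mk_iff' K _ _ p.coords_ne_zero q.coords_ne_zero).mpr h1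
  exact (Projectivization.mk_rep (K := K) (V := Fin (m + 1) → K) p).symm.trans
    (h2.trans (Projectivization.mk_rep (K := K) (V := Fin (m + 1) → K) q))

theorem exists_smul_coords_of_mem_projFiber {A : Matrix (Fin (n + 1)) (Fin (m + 1)) K}
    {Z : Set (PSpace K m)} {q : PSpace K n} {p : PSpace K m} (hp : p ∈ projFiber A Z q)
    {c : K} (hc : c ≠ 0) : ∃ b : K, b ≠ 0 ∧ A.mulVec (b • p.coords) = c • q.coords := by
  obtain ⟨-, hpA, rfl⟩ := hp
  obtain ⟨a, ha⟩ := exists_coords_ofCoords (A.mulVec p.coords) hpA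
  refine ⟨c * a, mul_ne_zero hc a.ne_zero, ?_⟩
  rw [proj, ← ha, Matrix.mulVec_smul, mul_smul]
  rfl

end Points

/-! ### Assembly of the main theorem -/

section MainTheorem

open MvPolynomial AlgebraicIndependent

/-- The generic points of a variety of dimension less than `n` have rank at most `n`. -/
theorem eRk_range_le_of_chainsLT {K : Type*} [Field K] [IsAlgClosed K] {m n : ℕ}
    {S : Set (MvPolynomial (Fin (m + 1)) K)}
    (hS : ChainsLT (zeroLocus S) n) (hclosed : IsClosed (zeroLocus S))
    (L : Type*) [Field L] [Algebra K L]
    (x : Fin (m + 1) → L) (hx : Satisfies S x) : (matroid K L).eRk (Set.range x) ≤ n := by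
  obtain ⟨a, ha⟩ := exists_linearForms n hclosed hS
  refine eRk_range_le_of_linearForms (fun k => isHomogeneous_linearForm (a k)) ?_ hx
  intro x hx hk
  by_contra hx0
  obtain ⟨k, hk'⟩ := ha _ (ofCoords_mem_zeroLocus hx hx0)
  rw [ne_eq, eval_coords_ofCoords_eq_zero_iff (isHomogeneous_linearForm (a k))] at hk'
  exact hk' (hk k)

end MainTheorem

end PSpace

open PSpace in
theorem mainTheorem8 {K : Type*} [Field K] [IsAlgClosed K] [CharZero K]
    (n s : ℕ) (hn : 2 ≤ n) (hs : 1 ≤ s)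
    (Z : Set (PSpace K (n + s))) (hZ : IsClosed Z) (hdim : PSpace.IsPureDim Z (n - 1)) :
    PSpace.ForGeneralProjection (m := n + s) (n := n) fun A =>
      A.rank = n + 1 ∧ Disjoint Z (PSpace.center A) ∧
        PSpace.CodimAtLeast (PSpace.tripleLocus A Z) 3 := by
  have hchain : ChainsLT Z n := by
    have h := chainsLT_of_components hdim
    rwa [Nat.sub_add_cancel (by omega)] at h
  obtain ⟨S, rfl⟩ := (isClosed_iff Z).mp hZ
  obtain ⟨F₁, hF₁, h₁⟩ := exists_forall_rank_eq (K := K) (show n + 1 ≤ n + s + 1 by omega)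
  obtain ⟨F₂, hF₂, h₂⟩ := exists_forall_mulVec_ne_zero fun L _ _ =>
    eRk_range_le_of_chainsLT hchain hZ L
  choose F₃ hF₃ h₃ using exists_forall_relation (show 1 ≤ n by omega) fun L _ _ =>
    eRk_range_le_of_chainsLT hchain hZ L
  -- The independent coordinates are not known in advance, so a relation is demanded for each of the
  -- finitely many choices `σ`.
  refine ⟨F₁ * F₂ * ∏ σ, F₃ σ,
    mul_ne_zero (mul_ne_zero hF₁ hF₂) (Finset.prod_ne_zero_iff.mpr fun σ _ => hF₃ σ), ?_⟩
  intro A hA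
  rw [map_mul, map_mul, map_prod] at hA
  have hA₁ := left_ne_zero_of_mul (left_ne_zero_of_mul hA)
  have hA₂ := right_ne_zero_of_mul (left_ne_zero_of_mul hA)
  have hA₃ := fun σ => Finset.prod_ne_zero_iff.mp (right_ne_zero_of_mul hA) σ (Finset.mem_univ σ)
  refine ⟨h₁ A hA₁, ?_, ?_⟩
  · rw [Set.disjoint_left]
    exact fun p hpZ hpA => h₂ A hA₂ _ (satisfies_coords hpZ) p.coords_ne_zero hpA
  · refine topologicalKrullDim_add_le isClosed_closure fun p hp => ?_
    -- With `k = n - 1` the bound is `length + 3 ≤ n`. For `n = 2` it admits no chain, so the locus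
    -- is empty.
    have h := length_add_two_le (k := n - 1) (fun σ => ?_) p hp
    · omega
    · obtain ⟨G, hG0, hG⟩ := h₃ σ A (hA₃ σ)
      refine ⟨G, hG0, fun q hq c hc => ?_⟩
      obtain ⟨R, hR, hR3⟩ := Set.exists_subset_encard_eq hq.2
      obtain ⟨p₁, p₂, p₃, h12, h13, h23, rfl⟩ := Set.encard_eq_three.mp hR3
      have hp₁ := hR (show p₁ ∈ ({p₁, p₂, p₃} : Set _) by simp)
      have hp₂ := hR (show p₂ ∈ ({p₁, p₂, p₃} : Set _) by simp)
      have hp₃ := hR (show p₃ ∈ ({p₁, p₂, p₃} : Set _) by simp)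
      -- The three representatives are rescaled so that their images agree as vectors, all equal to
      -- `c • q.coords`.
      obtain ⟨b₁, hb₁, hq₁⟩ := exists_smul_coords_of_mem_projFiber hp₁ hc
      obtain ⟨b₂, hb₂, hq₂⟩ := exists_smul_coords_of_mem_projFiber hp₂ hc
      obtain ⟨b₃, -, hq₃⟩ := exists_smul_coords_of_mem_projFiber hp₃ hc
      have := hG _ _ _ ((satisfies_coords hp₁.1).smul b₁) ((satisfies_coords hp₂.1).smul b₂)
        ((satisfies_coords hp₃.1).smul b₃) (fun h => h12 (eq_of_smul_coords_eq hb₁ h))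
        (fun h => h13 (eq_of_smul_coords_eq hb₁ h))
        (fun h => h23 (eq_of_smul_coords_eq hb₂ h)) (hq₁.trans hq₂.symm) (hq₁.trans hq₃.symm)
      rw [hq₁] at this
      exact this
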